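/- Let $\overline{\mathbf Q}$ be an algebraic closure of $\mathbf Q$ and let $a_1,\dots,a_n$ be positive integers. A diameter four tree of type $(a_1,\dots,a_n)$ over $\overline{\mathbf Q}$ is an isomorphism class $\mathcal T=[\beta]$ of coverings $\beta:\mathbf P^1\to\mathbf P^1$ over $\overline{\mathbf Q}$ that are étale outside $\{0,1,\infty\}$, totally ramified above $\infty$, whose fibre above $0$ consists of $n$ points with ramification indices $a_1,\dots,a_n$, and for which exactly one point of the fibre above $1$ is ramified (so that $n\ge 2$); two coverings $\beta_1,\beta_2$ are isomorphic if $\beta_2=\beta_1\circ\varphi$ for some $\varphi\in\mathrm{PGL}_2(\overline{\mathbf Q})$. The field of moduli $\mathbf Q(\mathcal T)$ is the subfield of $\overline{\mathbf Q}$ fixed by all $\sigma\in\mathrm{Gal}(\overline{\mathbf Q}/\mathbf Q)$ such that ${}^\sigma\beta\cong\beta$; it is a number field. For $i\in\{1,\dots,n\}$, a prime number $p$ is called $a_i$-regular if $p$ divides $a_i$ but does not divide $$d_i(a_1,\dots,a_n)=\prod_{\emptyset\ne S\subseteq\{1,\dots,n\}\setminus\{i\}}\ \sum_{j\in S}a_j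 .$$ Let $\mathcal T$ be a diameter four tree of type $(a_1,\dots,a_n)$ over $\overline{\mathbf Q}$ and suppose that $p>n$ is an $a_i$-regular prime. Write $a_i=p^hm$ with $p\nmid m$. Then $\mathbf Q(\mathcal T)$ is a number field, and for every maximal ideal $\mathfrak p$ of its ring of integers lying over $p\mathbf Z$, the ramification index $e_{\mathfrak p}$ of $\mathfrak p$ over $p\mathbf Z$ satisfies $$e_{\mathfrak p}\le\frac{n-1}{\gcd(n-1,h)} .$$ -/

import Mathlib

open Polynomial OnePoint
open scoped NumberField MatrixGroups

noncomputable section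

namespace DiameterFour

variable {K : Type*} [Field K]

/-! ### Points and ramification of rational maps of the projective line

Over an algebraically closed field `K`, the points of the projective line are the elements of
`OnePoint K`, and a covering `P^1 → P^1` is a non-constant rational function
`f : RatFunc K`. -/

/-- The order of vanishing of a non-zero rational function `g` at a point of the projective line
(negative at a pole). -/
def ordAt (g : RatFunc K) (P : OnePoint K) : ℤ :=
  P.elim (-g.intDegree)
    (fun x => (g.num.rootMultiplicity x : ℤ) - (g.denom.rootMultiplicity x : ℤ))

/-- The multiplicity with which the non-constant rational map `f` takes the value `Q` at `P`.
It is positive exactly when `f P = Q`, and it is then the ramification index of `f` at `P`. -/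
def mult (f : RatFunc K) (P Q : OnePoint K) : ℕ :=
  (Q.elim (-ordAt f P) (fun c => ordAt (f - RatFunc.C c) P)).toNat

/-- The fibre of `f` above `Q`. -/
def fiber (f : RatFunc K) (Q : OnePoint K) : Set (OnePoint K) :=
  {P | 0 < mult f P Q}

/-- The coverings of the projective line whose isomorphism classes are the diameter four trees of
type `(a_1, …, a_n)`. -/
structure IsCover {n : ℕ} (a : Fin n → ℕ) (f : RatFunc K) : Prop where
  nonconstant : ∀ c : K, f ≠ RatFunc.C c
  /-- `f` is étale outside `0, 1, ∞`. -/
  etale : ∀ Q : OnePoint K, Q ≠ ((0 : K) : OnePoint K) → Q ≠ ((1 : K) : OnePoint K) → Q ≠ ∞ →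
    ∀ P ∈ fiber f Q, mult f P Q = 1
  /-- The ramification is tame. -/
  tame : ∀ P Q : OnePoint K, P ∈ fiber f Q → (mult f P Q : K) ≠ 0
  /-- `f` is totally ramified above `∞`: there is exactly one point in the fibre. -/
  totally_ramified : ∃! P : OnePoint K, P ∈ fiber f ∞
  /-- The fibre above `0` consists of `n` points, of ramification indices `a_1, …, a_n`. -/
  fiber_zero : ∃ x : Fin n → OnePoint K, Function.Injective x ∧
    Set.range x = fiber f ((0 : K) : OnePoint K) ∧
    ∀ i, mult f (x i) ((0 : K) : OnePoint K) = a i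
  /-- There is exactly one ramified point in the fibre above `1`. -/
  fiber_one : ∃! P : OnePoint K, P ∈ fiber f ((1 : K) : OnePoint K) ∧
    1 < mult f P ((1 : K) : OnePoint K)

/-! ### Isomorphism of coverings -/

/-- The automorphism `X ↦ (aX + b) / (cX + d)` of the projective line attached to an invertible
matrix, as a rational function. -/
def mobius (g : GL (Fin 2) K) : RatFunc K :=
  (RatFunc.C (g 0 0) * RatFunc.X + RatFunc.C (g 0 1)) /
    (RatFunc.C (g 1 0) * RatFunc.X + RatFunc.C (g 1 1))

/-- The composite `f ∘ φ`, where `φ` is the automorphism attached to `g`. -/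
def precomp (f : RatFunc K) (g : GL (Fin 2) K) : RatFunc K :=
  f.eval RatFunc.C (mobius g)

/-- Two coverings are isomorphic when they differ by an automorphism of the source. -/
def Isomorphic (f₁ f₂ : RatFunc K) : Prop :=
  ∃ g : GL (Fin 2) K, f₂ = precomp f₁ g

lemma linear_ne_zero {a b : K} (h : a ≠ 0 ∨ b ≠ 0) :
    (RatFunc.C a * RatFunc.X + RatFunc.C b : RatFunc K) ≠ 0 := by
  intro h0
  have h1 : algebraMap K[X] (RatFunc K) (Polynomial.C a * Polynomial.X + Polynomial.C b) = 0 := by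
    simpa using h0
  rw [map_eq_zero_iff _ (RatFunc.algebraMap_injective K)] at h1
  have ha := congrArg (fun q => Polynomial.coeff q 1) h1
  have hb := congrArg (fun q => Polynomial.coeff q 0) h1
  simp at ha hb
  tauto

lemma det_ne (g : GL (Fin 2) K) : g 0 0 * g 1 1 - g 0 1 * g 1 0 ≠ 0 := by
  have h := g.det_ne_zero
  rwa [Matrix.det_fin_two] at h

lemma denom_ne (g : GL (Fin 2) K) :
    (RatFunc.C (g 1 0) * RatFunc.X + RatFunc.C (g 1 1) : RatFunc K) ≠ 0 := by
  apply linear_ne_zero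
  by_contra! h
  apply det_ne g
  rw [h.1, h.2]
  ring

lemma mobius_ne_C (g : GL (Fin 2) K) : ¬ ∃ c, mobius g = RatFunc.C c := by
  rintro ⟨c, hc⟩
  rw [mobius, div_eq_iff (denom_ne g)] at hc
  have h0 : (RatFunc.C (g 0 0 - c * g 1 0) * RatFunc.X + RatFunc.C (g 0 1 - c * g 1 1) :
      RatFunc K) = 0 := by
    simp only [map_sub, map_mul]
    linear_combination hc
  by_cases h : g 0 0 - c * g 1 0 ≠ 0 ∨ g 0 1 - c * g 1 1 ≠ 0
  · exact linear_ne_zero h h0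
  · push Not at h
    apply det_ne g
    linear_combination g 1 1 * h.1 - g 1 0 * h.2

lemma precomp_div (p q : K[X]) (g : GL (Fin 2) K) (hq : q ≠ 0) :
    precomp (algebraMap K[X] (RatFunc K) p / algebraMap K[X] (RatFunc K) q) g =
      aeval (mobius g) p / aeval (mobius g) q := by
  have ht := RatFunc.transcendental_of_ne_C _ (mobius_ne_C g)
  have hne : ∀ r : K[X], r ≠ 0 → aeval (mobius g) r ≠ 0 := fun r hr h0 =>
    hr ((transcendental_iff.mp ht) r h0)
  set f := algebraMap K[X] (RatFunc K) p / algebraMap K[X] (RatFunc K) q with hf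
  have hq' : algebraMap K[X] (RatFunc K) q ≠ 0 := by
    rwa [Ne, map_eq_zero_iff _ (RatFunc.algebraMap_injective K)]
  have hd' : algebraMap K[X] (RatFunc K) f.denom ≠ 0 := by
    rw [Ne, map_eq_zero_iff _ (RatFunc.algebraMap_injective K)]
    exact f.denom_ne_zero
  have h1 : f.num * q = p * f.denom := by
    apply RatFunc.algebraMap_injective K
    rw [map_mul, map_mul, ← div_eq_div_iff hd' hq', RatFunc.num_div_denom]
  have h2 := congrArg (aeval (mobius g)) h1
  rw [map_mul, map_mul] at h2
  rw [precomp, RatFunc.eval]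
  change aeval (mobius g) f.num / aeval (mobius g) f.denom = _
  rw [div_eq_div_iff (hne _ f.denom_ne_zero) (hne _ hq)]
  exact h2

/-- Composition with an automorphism, as an endomorphism of the function field. -/
def precompHom (g : GL (Fin 2) K) : RatFunc K →ₐ[K] RatFunc K :=
  RatFunc.liftAlgHom (aeval (mobius g)) (by
    have ht := RatFunc.transcendental_of_ne_C _ (mobius_ne_C g)
    intro r hr
    simp only [Submonoid.mem_comap, mem_nonZeroDivisors_iff_ne_zero] at hr ⊢
    exact fun h0 => hr ((transcendental_iff.mp ht) r h0))

lemma precomp_eq (f : RatFunc K) (g : GL (Fin 2) K) : precomp f g = precompHom g f := by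
  conv_lhs => rw [← RatFunc.num_div_denom f]
  rw [precomp_div _ _ _ f.denom_ne_zero, precompHom, RatFunc.liftAlgHom_apply]

lemma precompHom_X (g : GL (Fin 2) K) : precompHom g RatFunc.X = mobius g := by
  rw [← precomp_eq, precomp, RatFunc.eval_X]

lemma precompHom_C (g : GL (Fin 2) K) (c : K) : precompHom g (RatFunc.C c) = RatFunc.C c := by
  rw [← precomp_eq, precomp, RatFunc.eval_C]

lemma precompHom_mobius (g g' : GL (Fin 2) K) :
    precompHom g' (mobius g) = mobius (g * g') := by
  have ht : mobius g' * (RatFunc.C (g' 1 0) * RatFunc.X + RatFunc.C (g' 1 1)) =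
      RatFunc.C (g' 0 0) * RatFunc.X + RatFunc.C (g' 0 1) :=
    div_mul_cancel₀ _ (denom_ne g')
  have hd1 : precompHom g' (RatFunc.C (g 1 0) * RatFunc.X + RatFunc.C (g 1 1)) ≠ 0 :=
    (_root_.map_ne_zero _).mpr (denom_ne g)
  have h1 : mobius g = (RatFunc.C (g 0 0) * RatFunc.X + RatFunc.C (g 0 1)) /
    (RatFunc.C (g 1 0) * RatFunc.X + RatFunc.C (g 1 1)) := rfl
  have h2 : mobius (g * g') =
    (RatFunc.C ((g * g') 0 0) * RatFunc.X + RatFunc.C ((g * g') 0 1)) /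
    (RatFunc.C ((g * g') 1 0) * RatFunc.X + RatFunc.C ((g * g') 1 1)) := rfl
  rw [h1, h2, map_div₀, div_eq_div_iff hd1 (denom_ne (g * g'))]
  simp only [map_add, map_mul, precompHom_X, precompHom_C, Units.val_mul,
    Matrix.mul_apply, Fin.sum_univ_two]
  linear_combination (RatFunc.C (g 0 0) * RatFunc.C (g 1 1) -
    RatFunc.C (g 0 1) * RatFunc.C (g 1 0)) * ht

lemma precomp_precomp (f : RatFunc K) (g g' : GL (Fin 2) K) :
    precomp (precomp f g) g' = precomp f (g * g') := by
  have h : ∀ p : K[X], precompHom g' (aeval (mobius g) p) = aeval (mobius (g * g')) p := by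
    intro p
    rw [← precompHom_mobius, aeval_algHom_apply]
  rw [← RatFunc.num_div_denom f, precomp_div _ _ _ f.denom_ne_zero,
    precomp_div _ _ _ f.denom_ne_zero, precomp_eq, map_div₀, h, h]

lemma precomp_one (f : RatFunc K) : precomp f 1 = f := by
  have h1 : mobius (1 : GL (Fin 2) K) = RatFunc.X := by simp [mobius]
  have h : ∀ p : K[X], aeval (RatFunc.X : RatFunc K) p = algebraMap K[X] (RatFunc K) p := by
    intro p
    rw [← RatFunc.algebraMap_X, aeval_algebraMap_apply, aeval_X_left_apply]
  conv_lhs => rw [← RatFunc.num_div_denom f]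
  rw [precomp_div _ _ _ f.denom_ne_zero, h1, h, h, RatFunc.num_div_denom]

lemma isomorphic_equivalence : Equivalence (Isomorphic (K := K)) where
  refl f := ⟨1, (precomp_one f).symm⟩
  symm := by
    rintro f₁ f₂ ⟨g, rfl⟩
    exact ⟨g⁻¹, by rw [precomp_precomp, mul_inv_cancel, precomp_one]⟩
  trans := by
    rintro f₁ f₂ f₃ ⟨g, rfl⟩ ⟨g', rfl⟩
    exact ⟨g * g', by rw [precomp_precomp]⟩

variable (K) in
/-- Isomorphism of coverings, on the coverings of type `(a_1, …, a_n)`. -/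
def coverSetoid {n : ℕ} (a : Fin n → ℕ) : Setoid {f : RatFunc K // IsCover a f} :=
  Setoid.mk (fun f₁ f₂ => Isomorphic f₁.1 f₂.1) (isomorphic_equivalence.comap Subtype.val)

variable (K) in
/-- A diameter four tree over `K` of type `(a_1, …, a_n)`: an isomorphism class of coverings. -/
def Tree {n : ℕ} (a : Fin n → ℕ) : Type _ :=
  Quotient (coverSetoid K a)

/-- The diameter four tree attached to a covering. -/
def Tree.mk {n : ℕ} {a : Fin n → ℕ} (f : RatFunc K) (hf : IsCover a f) : Tree K a :=
  Quotient.mk (coverSetoid K a) ⟨f, hf⟩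

/-! ### Galois action and field of moduli -/

/-- The action of an automorphism of `K` on rational functions through their coefficients. -/
def conj (σ : K ≃+* K) (f : RatFunc K) : RatFunc K :=
  algebraMap K[X] (RatFunc K) (f.num.map (σ : K →+* K)) /
    algebraMap K[X] (RatFunc K) (f.denom.map (σ : K →+* K))

/-- The field of moduli of a tree `T = [f]` with respect to the base field `F`: the subfield of `K`
fixed by all the `σ` in `Gal(K/F)` such that `f` and its conjugate by `σ` are isomorphic. -/
def fieldOfModuli (F : Type*) [Field F] [Algebra F K] {n : ℕ} {a : Fin n → ℕ} (T : Tree K a) :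
    IntermediateField F K where
  carrier := {x | ∀ σ : K ≃ₐ[F] K,
    (∃ (f : RatFunc K) (hf : IsCover a f), Tree.mk f hf = T ∧
      Isomorphic f (conj (σ : K ≃+* K) f)) → σ x = x}
  mul_mem' hx hy σ hσ := by rw [map_mul, hx σ hσ, hy σ hσ]
  add_mem' hx hy σ hσ := by rw [map_add, hx σ hσ, hy σ hσ]
  inv_mem' x hx σ hσ := by rw [map_inv₀, hx σ hσ]
  algebraMap_mem' r σ _ := σ.commutes r

/-! ### Regular primes -/

/-- The integer `d_i(a_1, …, a_n)`: the product, over all the non-empty subsets `S` of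
`{1, …, n}` that do not contain `i`, of the sums of the `a_j` with `j` in `S`. -/
def dWithout {n : ℕ} (a : Fin n → ℕ) (i : Fin n) : ℕ :=
  ∏ S ∈ (Finset.univ.erase i).powerset.erase ∅, ∑ j ∈ S, a j

/-- The prime `p` is `a_i`-regular: it divides `a_i` but not `d_i(a_1, …, a_n)`. -/
def IsRegularPrime {n : ℕ} (a : Fin n → ℕ) (i : Fin n) (p : ℕ) : Prop :=
  p.Prime ∧ p ∣ a i ∧ ¬ p ∣ dWithout a i

end DiameterFour

end

/-! Move the pole to ∞, the ramified point above 1 to 0, and the zero of index a_i to 1. The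
covering becomes a polynomial F = c ∏ (X - ξ_j)^{a_j} with F(0) = 1, and counting critical points
shows that X^{n-1} divides F' (`exists_polynomial_of_normalized`). Expanding F'/F at 0 turns this
into ∑ a_j y_j^k = 0 for 1 ≤ k ≤ n - 1, where y_j = 1/ξ_j and y_i = 1 (`sum_mul_inv_pow_eq_zero`).
An automorphism fixing every y_j fixes F, so the field of moduli lies in ℚ(y).

Now work at a prime above p, with the system ∑_{j ≠ i} a_j y_j^k = -a_i. By regularity, no non-empty
subsum of the a_j with j ≠ i vanishes modulo p, so too many vanishing power sums would kill all
residues. This forces the largest |y_j|, j ≠ i, to satisfy |y_j|^{n-1} = |a_i| = |p^h|. With g =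
gcd(n-1, h), choose t such that t^{(n-1)/g} = p^{h/g}: it has that same absolute value, and the
y_j/t are integral with distinct residues. An inertia element fixing t sends this solution of the
rescaled system to a congruent one. As p > n, the Jacobian, a Vandermonde determinant up to units,
is a unit, so Hensel uniqueness shows that the y_j are fixed (`map_eq_of_powerSums_eq`).

Hence the stabilizer of t in the inertia group acts trivially on the field of moduli, and the
ramification index is at most the size of the orbit of t, which is at most (n-1)/g
(`ramificationIdx_le_of_inertia`). -/

noncomputable section

namespace DiameterFour

/-! ### Weighted power sums over a field -/

section PowerSums

lemma sum_mul_eval_eq_zero {R ι : Type*} [CommRing R] (s : Finset ι) (c w : ι → R) (m : ℕ)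
    (h : ∀ k, 1 ≤ k → k ≤ m → ∑ j ∈ s, c j * w j ^ k = 0) (q : R[X]) (hq : q.natDegree ≤ m)
    (hq0 : q.coeff 0 = 0) : ∑ j ∈ s, c j * q.eval (w j) = 0 := by
  have h1 : ∀ j, q.eval (w j) = ∑ k ∈ Finset.range (m + 1), q.coeff k * w j ^ k := fun j =>
    Polynomial.eval_eq_sum_range' (Nat.lt_succ_of_le hq) _
  simp_rw [h1, Finset.mul_sum]
  rw [Finset.sum_comm]
  refine Finset.sum_eq_zero fun k hk => ?_
  rcases Nat.eq_zero_or_pos k with rfl | hk0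
  · simp [hq0]
  · have := h k hk0 (Nat.lt_succ_iff.mp (Finset.mem_range.mp hk))
    calc ∑ j ∈ s, c j * (q.coeff k * w j ^ k) = q.coeff k * ∑ j ∈ s, c j * w j ^ k := by
          rw [Finset.mul_sum]; exact Finset.sum_congr rfl fun j _ => by ring
      _ = 0 := by rw [this, mul_zero]

/-- If no non-empty subfamily of the weights has sum zero, the vanishing of as many weighted power
sums as there are distinct non-zero values forces all the values to vanish. -/
lemma eq_zero_of_powerSums_eq_zero {κ ι : Type*} [Field κ] [DecidableEq κ] (s : Finset ι)
    (c w : ι → κ) (m : ℕ) (hcard : ((s.image w).erase 0).card ≤ m)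
    (hc : ∀ S ⊆ s, S.Nonempty → ∑ j ∈ S, c j ≠ 0)
    (h : ∀ k, 1 ≤ k → k ≤ m → ∑ j ∈ s, c j * w j ^ k = 0) : ∀ j ∈ s, w j = 0 := by
  intro j hj
  by_contra hw
  set V := (s.image w).erase 0 with hV
  have hjV : w j ∈ V := Finset.mem_erase.mpr ⟨hw, Finset.mem_image_of_mem w hj⟩
  -- This interpolation polynomial vanishes at 0 and at every value other than `w j`, so the
  -- weighted sum of its values is `q(w j)` times the total weight of the indices sharing the value
  -- `w j`.
  set q : κ[X] := X * ∏ x ∈ V.erase (w j), (X - C x) with hq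
  have hdeg : q.natDegree ≤ m := by
    refine le_trans (natDegree_mul_le) ?_
    rw [natDegree_prod_of_monic _ _ fun x _ => monic_X_sub_C x]
    simp only [natDegree_X, natDegree_X_sub_C, Finset.sum_const, smul_eq_mul, mul_one,
      Finset.card_erase_of_mem hjV]
    have : 0 < V.card := Finset.card_pos.mpr ⟨_, hjV⟩
    omega
  have hsum := sum_mul_eval_eq_zero s c w m h q hdeg (by simp [hq])
  have hval : ∀ l ∈ s, c l * q.eval (w l) = if w l = w j then c l * q.eval (w j) else 0 := by
    intro l hl
    split_ifs with hlj
    · rw [hlj]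
    · by_cases h0 : w l = 0
      · simp [hq, h0]
      · have : w l ∈ V.erase (w j) :=
          Finset.mem_erase.mpr ⟨hlj, Finset.mem_erase.mpr ⟨h0, Finset.mem_image_of_mem w hl⟩⟩
        simp only [hq, eval_mul, eval_prod]
        rw [Finset.prod_eq_zero this (by simp)]
        ring
  rw [Finset.sum_congr rfl hval, ← Finset.sum_filter, ← Finset.sum_mul] at hsum
  rcases mul_eq_zero.mp hsum with h1 | h1
  · exact hc _ (Finset.filter_subset _ _) ⟨j, by simp [hj]⟩ h1
  · simp only [hq, eval_mul, eval_X, eval_prod, eval_sub, eval_C, mul_eq_zero,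
      Finset.prod_eq_zero_iff] at h1
    rcases h1 with h1 | ⟨x, hx, h1⟩
    · exact hw h1
    · exact (Finset.mem_erase.mp hx).1 (sub_eq_zero.mp h1).symm

end PowerSums

/-! ### Power sums over a valued field: sizes of solutions and Hensel uniqueness -/

section Valued

variable {M Γ ι : Type*} [Field M] [LinearOrderedCommGroupWithZero Γ] (v : Valuation M Γ)

/-- In the residue field the first `m` weighted power sums vanish while the residue of `w j₀` does
not. By `eq_zero_of_powerSums_eq_zero` there must be more than `m` distinct non-zero residues, and
with at most `m + 1` indices this leaves no room for a coincidence. -/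
lemma exists_small_difference (s : Finset ι) (a : ι → ℕ) (m : ℕ) (hm : s.card ≤ m + 1)
    (ha : ∀ S ⊆ s, S.Nonempty → v ((∑ j ∈ S, a j : ℕ) : M) = 1)
    (w : ι → M) (hw : ∀ j ∈ s, v (w j) ≤ 1) {j₀ : ι} (hj₀ : j₀ ∈ s) (hw₀ : v (w j₀) = 1)
    (h : ∀ k, 1 ≤ k → k ≤ m → v (∑ j ∈ s, (a j : M) * w j ^ k) < 1) :
    s.card = m + 1 ∧ ∀ j ∈ s, ∀ l ∈ s, j ≠ l → v (w j - w l) = 1 := by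
  classical
  let O := v.valuationSubring
  have hmem : ∀ x : M, x ∈ O ↔ v x ≤ 1 := fun x => v.mem_valuationSubring_iff x
  let W : ι → O := fun j => if hj : j ∈ s then ⟨w j, (hmem _).mpr (hw j hj)⟩ else 0
  have hW : ∀ j ∈ s, (W j : M) = w j := fun j hj => by simp [W, hj]
  have hres : ∀ x : O, IsLocalRing.residue O x = 0 ↔ v (x : M) < 1 := by
    intro x
    rw [IsLocalRing.residue_eq_zero_iff, IsLocalRing.mem_maximalIdeal, mem_nonunits_iff]
    exact Valuation.Integer.not_isUnit_iff_valuation_lt_one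
  have key : ¬ (((s.image fun j => IsLocalRing.residue O (W j)).erase 0).card ≤ m) := by
    intro hcard
    have := eq_zero_of_powerSums_eq_zero s (fun j => IsLocalRing.residue O (a j : O))
      (fun j => IsLocalRing.residue O (W j)) m hcard ?_ ?_ j₀ hj₀
    · rw [hres, hW _ hj₀, hw₀] at this
      exact lt_irrefl _ this
    · intro S hS hne
      rw [← map_sum, Ne, hres]
      have := ha S hS hne
      push_cast at this ⊢
      rw [this]
      exact lt_irrefl _
    · intro k hk1 hkm
      simp_rw [← map_pow, ← map_mul]
      rw [← map_sum, hres]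
      push_cast
      rw [Finset.sum_congr rfl fun j hj => by rw [hW j hj]]
      exact h k hk1 hkm
  have hle : ((s.image fun j => IsLocalRing.residue O (W j)).erase 0).card ≤
      (s.image fun j => IsLocalRing.residue O (W j)).card := Finset.card_erase_le
  have hle2 : (s.image fun j => IsLocalRing.residue O (W j)).card ≤ s.card :=
    Finset.card_image_le
  refine ⟨by omega, fun j hj l hl hjl => ?_⟩
  have hinj := Finset.card_image_iff.mp (show
    (s.image fun j => IsLocalRing.residue O (W j)).card = s.card by omega)
  by_contra hne
  apply hjl
  apply hinj hj hl
  simp only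
  rw [← sub_eq_zero, ← map_sub, hres]
  push_cast
  rw [hW j hj, hW l hl]
  refine lt_of_le_of_ne ?_ hne
  exact (v.map_sub _ _).trans (max_le (hw j hj) (hw l hl))

/-- Uniqueness in Hensel's lemma for a system of weighted power sums. -/
lemma eq_of_powerSums_eq (s : Finset ι) (a : ι → ℕ) (ha : ∀ j ∈ s, v (a j : M) = 1)
    (hk : ∀ k : ℕ, 1 ≤ k → k ≤ s.card → v (k : M) = 1)
    (z z' : ι → M) (hz : ∀ j ∈ s, v (z j) ≤ 1) (hzz : ∀ j ∈ s, v (z' j - z j) < 1)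
    (hdist : ∀ j ∈ s, ∀ l ∈ s, j ≠ l → v (z j - z l) = 1)
    (h : ∀ k, 1 ≤ k → k ≤ s.card →
      ∑ j ∈ s, (a j : M) * z' j ^ k = ∑ j ∈ s, (a j : M) * z j ^ k) :
    ∀ j ∈ s, z' j = z j := by
  classical
  by_contra! hcon
  obtain ⟨j₁, hj₁, hne⟩ := hcon
  -- Newton-style contradiction: the largest displacement `μ` lies strictly between 0 and 1, yet
  -- will satisfy `μ ≤ μ ^ 2`.
  obtain ⟨j₀, hj₀, hmax⟩ := s.exists_max_image (fun j => v (z' j - z j)) ⟨j₁, hj₁⟩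
  set μ := v (z' j₀ - z j₀) with hμ
  have hμ0 : 0 < μ := lt_of_lt_of_le ((Valuation.pos_iff v).mpr (sub_ne_zero.mpr hne)) (hmax j₁ hj₁)
  have hμ1 : μ < 1 := hzz j₀ hj₀
  -- First-order expansion of the `k`-th power at `z j`; the remainder is an integral multiple of
  -- the squared displacement.
  have taylor : ∀ j ∈ s, ∀ k : ℕ,
      v (z' j ^ k - z j ^ k - k * z j ^ (k - 1) * (z' j - z j)) ≤ μ ^ 2 := by
    intro j hj k
    have hz' : v (z' j) ≤ 1 := by
      have : z' j = (z' j - z j) + z j := by ring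
      rw [this]
      exact (v.map_add _ _).trans (max_le (hzz j hj).le (hz j hj))
    have hvk : ∀ k : ℕ, v (k : M) ≤ 1 := fun k => natCast_mem v.integer k
    induction k with
    | zero => simp
    | succ k ih =>
      have h1 : z' j ^ (k + 1) - z j ^ (k + 1) -
          (k + 1 : ℕ) * z j ^ (k + 1 - 1) * (z' j - z j) =
          z' j * (z' j ^ k - z j ^ k - k * z j ^ (k - 1) * (z' j - z j)) +
          k * z j ^ (k - 1) * (z' j - z j) ^ 2 := by
        rcases k with _ | k
        · simp
        · simp only [add_tsub_cancel_right]
          push_cast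
          ring
      rw [h1]
      refine (v.map_add _ _).trans (max_le ?_ ?_)
      · rw [v.map_mul]
        exact (mul_le_mul' hz' ih).trans (one_mul _).le
      · rw [v.map_mul, v.map_mul, v.map_pow, v.map_pow]
        refine (mul_le_mul' (mul_le_mul' (hvk k) (pow_le_one' (hz j hj) _))
          (pow_le_pow_left' (hmax j hj) 2)).trans ?_
        rw [one_mul, one_mul]
  -- Linearization of the equation of exponent `k + 1`; its factor `k + 1` is a unit by `hk`.
  have lin : ∀ k, k < s.card → v (∑ j ∈ s, a j * (z' j - z j) * z j ^ k) ≤ μ ^ 2 := by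
    intro k hkc
    have h1 : (k + 1 : ℕ) * ∑ j ∈ s, (a j : M) * (z' j - z j) * z j ^ k =
        - ∑ j ∈ s, a j * (z' j ^ (k + 1) - z j ^ (k + 1) -
          (k + 1 : ℕ) * z j ^ (k + 1 - 1) * (z' j - z j)) := by
      have h0 := sub_eq_zero.mpr (h (k + 1) (by omega) hkc)
      rw [← Finset.sum_sub_distrib] at h0
      rw [← sub_eq_zero, sub_neg_eq_add, Finset.mul_sum, ← Finset.sum_add_distrib, ← h0]
      refine Finset.sum_congr rfl fun j _ => ?_
      rw [add_tsub_cancel_right]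
      ring
    have h2 : v ((k + 1 : ℕ) * ∑ j ∈ s, (a j : M) * (z' j - z j) * z j ^ k) ≤ μ ^ 2 := by
      rw [h1, v.map_neg]
      refine v.map_sum_le fun j hj => ?_
      rw [v.map_mul, ha j hj, one_mul]
      exact taylor j hj _
    rwa [v.map_mul, hk _ (by omega) hkc, one_mul] at h2
  set O := v.integer
  let Z : ι → O := fun j => if hj : j ∈ s then ⟨z j, hz j hj⟩ else 0
  have hZ : ∀ j ∈ s, (Z j : M) = z j := fun j hj => by simp [Z, hj]
  -- A Lagrange polynomial inverts the Vandermonde system: combining the linearized equations with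
  -- its integral coefficients isolates index `j₀`, and its value there is a unit because the
  -- residues are distinct.
  let q : O[X] := ∏ l ∈ s.erase j₀, (X - C (Z l))
  have hqdeg : q.natDegree < s.card := by
    rw [natDegree_prod_of_monic _ _ fun x _ => monic_X_sub_C _]
    simp only [natDegree_X_sub_C, Finset.sum_const, smul_eq_mul, mul_one,
      Finset.card_erase_of_mem hj₀]
    have : 0 < s.card := Finset.card_pos.mpr ⟨_, hj₀⟩
    omega
  have hqv : v (∑ j ∈ s, a j * (z' j - z j) * ((q.eval (Z j) : O) : M)) ≤ μ ^ 2 := by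
    have : ∑ j ∈ s, a j * (z' j - z j) * ((q.eval (Z j) : O) : M) =
        ∑ k ∈ Finset.range s.card, (q.coeff k : M) * ∑ j ∈ s, a j * (z' j - z j) * z j ^ k := by
      simp_rw [Finset.mul_sum]
      rw [Finset.sum_comm]
      refine Finset.sum_congr rfl fun j hj => ?_
      rw [Polynomial.eval_eq_sum_range' hqdeg]
      push_cast
      rw [Finset.mul_sum, hZ j hj]
      exact Finset.sum_congr rfl fun k _ => by ring
    rw [this]
    refine v.map_sum_le fun k hk => ?_
    rw [v.map_mul]
    calc _ ≤ 1 * μ ^ 2 := mul_le_mul' (q.coeff k).2 (lin k (Finset.mem_range.mp hk))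
      _ = _ := one_mul _
  have hq0 : ∀ j ∈ s, j ≠ j₀ → q.eval (Z j) = 0 := by
    intro j hj hne
    simp only [q, eval_prod]
    exact Finset.prod_eq_zero (Finset.mem_erase.mpr ⟨hne, hj⟩) (by simp)
  have hq1 : v ((q.eval (Z j₀) : O) : M) = 1 := by
    simp only [q, eval_prod, eval_sub, eval_X, eval_C]
    push_cast
    rw [map_prod]
    refine Finset.prod_eq_one fun l hl => ?_
    rw [hZ _ hj₀, hZ _ (Finset.mem_of_mem_erase hl)]
    exact hdist _ hj₀ _ (Finset.mem_of_mem_erase hl) (Finset.ne_of_mem_erase hl).symm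
  rw [Finset.sum_eq_single_of_mem j₀ hj₀ (fun j hj hne => by simp [hq0 j hj hne]), v.map_mul,
    v.map_mul, ha _ hj₀, hq1, one_mul, mul_one, ← hμ, sq] at hqv
  have : μ * μ < μ * 1 := (mul_lt_mul_iff_right₀ hμ0).mpr hμ1
  rw [mul_one] at this
  exact absurd (lt_of_le_of_lt hqv this) (lt_irrefl _)

/-- The local analysis of the equations `∑ a_j y_j ^ k = -b`: a ring endomorphism that is congruent
to the identity and fixes an element `t` such that `v t ^ d = v b` fixes all the solutions. -/
lemma map_eq_of_powerSums_eq (s : Finset ι) (hs : s.Nonempty) (a : ι → ℕ) (b : ℕ)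
    (ha : ∀ S ⊆ s, S.Nonempty → v ((∑ j ∈ S, a j : ℕ) : M) = 1)
    (hb : v (b : M) < 1) (hb0 : (b : M) ≠ 0)
    (hk : ∀ k : ℕ, 1 ≤ k → k ≤ s.card → v (k : M) = 1)
    (y : ι → M) (h : ∀ k, 1 ≤ k → k ≤ s.card → ∑ j ∈ s, (a j : M) * y j ^ k = -b)
    (t : M) (ht : v t ^ s.card = v (b : M)) (σ : M →+* M)
    (hσ : ∀ x, v x ≤ 1 → v (σ x - x) < 1) (hσt : σ t = t) :
    ∀ j ∈ s, σ (y j) = y j := by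
  have hd : s.card ≠ 0 := (Finset.card_pos.mpr hs).ne'
  obtain ⟨j₀, hj₀, hmax⟩ := s.exists_max_image (fun j => v (y j)) hs
  set u := y j₀ with hu
  have hu0 : u ≠ 0 := by
    intro h0
    have hy : ∀ j ∈ s, y j = 0 := by
      intro j hj
      have := hmax j hj
      rw [h0, v.map_zero] at this
      exact (v.zero_iff).mp (le_antisymm this zero_le)
    have := h 1 le_rfl (by omega)
    rw [Finset.sum_eq_zero fun j hj => by rw [hy j hj]; simp] at this
    exact hb0 (neg_eq_zero.mp this.symm)
  have hvu0 : v u ≠ 0 := (v.ne_zero_iff).mpr hu0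
  have hsum : ∀ x : M, ∀ k, 1 ≤ k → k ≤ s.card →
      ∑ j ∈ s, (a j : M) * (y j / x) ^ k = -b / x ^ k := by
    intro x k h1 h2
    rw [← h k h1 h2, Finset.sum_div]
    exact Finset.sum_congr rfl fun j _ => by rw [div_pow, mul_div_assoc]
  -- After division by the largest solution `u`, the `k`-th power sum is `-b / u ^ k`. Taking `m =
  -- s.card` is contradictory and pins down the size of `u`; taking `m = s.card - 1` then separates
  -- the residues.
  have small : ∀ m, m ≤ s.card → s.card ≤ m + 1 → (∀ k, 1 ≤ k → k ≤ m → v (b : M) < v u ^ k) →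
      s.card = m + 1 ∧ ∀ j ∈ s, ∀ l ∈ s, j ≠ l → v (y j / u - y l / u) = 1 := by
    intro m hm1 hm2 hlt
    refine exists_small_difference v s a m hm2 ha _ (fun j hj => ?_) hj₀ ?_ fun k h1 h2 => ?_
    · rw [map_div₀]
      exact div_le_one_of_le₀ (hmax j hj) zero_le
    · rw [map_div₀, div_self hvu0]
    · rw [hsum u k h1 (h2.trans hm1), map_div₀, v.map_neg, v.map_pow, div_lt_one₀]
      · exact hlt k h1 h2
      · exact pow_pos (zero_lt_iff.mpr hvu0) _
  have hu1 : v u < 1 := by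
    by_contra hcon
    have := (small s.card le_rfl (Nat.le_succ _)
      fun k _ _ => hb.trans_le (one_le_pow_of_one_le' (not_lt.mp hcon) k)).1
    omega
  have hub : v u ^ s.card = v (b : M) := by
    refine le_antisymm (not_lt.mp fun hcon => ?_) ?_
    · have := (small s.card le_rfl (Nat.le_succ _)
        fun k _ h2 => hcon.trans_le (pow_le_pow_right_of_le_one' hu1.le h2)).1
      omega
    · rw [← v.map_neg, ← h s.card (by omega) le_rfl]
      refine v.map_sum_le fun j hj => ?_
      rw [v.map_mul, v.map_pow]
      exact (mul_le_mul' (natCast_mem v.integer (a j) : v (a j : M) ≤ 1)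
        (pow_le_pow_left' (hmax j hj) _)).trans (one_mul _).le
  have hut : v t = v u := by
    refine (pow_left_inj₀ zero_le zero_le hd).mp ?_
    rw [ht, hub]
  have ht0 : t ≠ 0 := by
    rw [← v.ne_zero_iff, hut]
    exact hvu0
  obtain ⟨-, hdist⟩ := small (s.card - 1) (by omega) (by omega) fun k _ h2 => by
    rw [← hub]
    exact pow_lt_pow_right_of_lt_one₀ (zero_lt_iff.mpr hvu0) hu1 (by omega)
  have hz : ∀ j ∈ s, v (y j / t) ≤ 1 := fun j hj => by
    rw [map_div₀, hut]
    exact div_le_one_of_le₀ (hmax j hj) zero_le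
  -- Since `σ` fixes `t`, the families `y j / t` and `σ (y j / t)` solve the same system, with
  -- right-hand sides `-b / t ^ k`.
  have heq := eq_of_powerSums_eq v s a (fun j hj => by
      simpa using ha {j} (by simpa using hj) (by simp)) hk (fun j => y j / t)
    (fun j => σ (y j / t)) hz (fun j hj => hσ _ (hz j hj)) (fun j hj l hl hjl => ?_)
    (fun k h1 h2 => ?_)
  · intro j hj
    have := heq j hj
    rwa [map_div₀, hσt, div_left_inj' ht0] at this
  · rw [← hdist j hj l hl hjl, ← sub_div, ← sub_div, map_div₀, map_div₀, hut]
  · have h3 := hsum t k h1 h2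
    have h4 := congrArg σ h3
    simp only [map_sum, map_mul, map_pow, map_natCast, map_div₀, map_neg, hσt] at h4 ⊢
    rw [h4, h3]

end Valued

/-! ### Inertia groups and the ramification bound -/

section Inertia

open scoped Pointwise

variable {F M : Type*} [Field F] [NumberField F] [Field M] [NumberField M] [Algebra F M]

lemma card_inertia_eq_ramificationIdx [IsGalois F M] (𝔭 : Ideal (𝓞 F)) [𝔭.IsMaximal]
    (h𝔭 : 𝔭 ≠ ⊥) (𝔮 : Ideal (𝓞 M)) [𝔮.IsPrime] [𝔮.LiesOver 𝔭] :
    Nat.card (𝔮.inertia Gal(M/F)) = 𝔮.ramificationIdx (𝓞 F) := by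
  have : Finite (𝓞 F ⧸ 𝔭) := Ideal.finiteQuotientOfFreeOfNeBot 𝔭 h𝔭
  have : Finite 𝔭.ResidueField := inferInstance
  rw [Ideal.card_inertia_eq_ramificationIdxIn 𝔭 𝔮,
    Ideal.ramificationIdxIn_eq_ramificationIdx 𝔭 𝔮 Gal(M/F)]

lemma card_inertia_eq_ramificationIdx_int [IsGalois ℚ M] (𝔮 : Ideal (𝓞 M)) [𝔮.IsPrime]
    (h𝔮 : 𝔮 ≠ ⊥) : Nat.card (𝔮.inertia Gal(M/ℚ)) = 𝔮.ramificationIdx ℤ := by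
  have : 𝔮.IsMaximal := Ring.DimensionLEOne.maximalOfPrime h𝔮 inferInstance
  have : (𝔮.under ℤ).IsMaximal := Ideal.IsMaximal.under ℤ 𝔮
  have hne : 𝔮.under ℤ ≠ ⊥ := Ideal.under_ne_bot ℤ h𝔮
  have : Finite (ℤ ⧸ 𝔮.under ℤ) := Ideal.finiteQuotientOfFreeOfNeBot _ hne
  have : Finite (𝔮.under ℤ).ResidueField := inferInstance
  rw [Ideal.card_inertia_eq_ramificationIdxIn (𝔮.under ℤ) 𝔮,
    Ideal.ramificationIdxIn_eq_ramificationIdx (𝔮.under ℤ) 𝔮 Gal(M/ℚ)]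

/-- If the elements of an inertia group that fix an `e`-th root `t` of a rational number act
trivially on the subfield `F`, then the ramification index of `F` is at most `e`. -/
lemma ramificationIdx_le_of_inertia [IsGalois ℚ M] (𝔭 : Ideal (𝓞 F)) [𝔭.IsMaximal]
    (h𝔭 : 𝔭 ≠ ⊥) (𝔮 : Ideal (𝓞 M)) [𝔮.IsPrime] [𝔮.LiesOver 𝔭] (t : M) (e : ℕ) (he : e ≠ 0) (r : ℚ)
    (ht : t ^ e = algebraMap ℚ M r)
    (H : ∀ σ ∈ 𝔮.inertia Gal(M/ℚ), σ t = t → ∀ x : F, σ (algebraMap F M x) = algebraMap F M x) :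
    𝔭.ramificationIdx ℤ ≤ e := by
  classical
  have : IsGalois F M := IsGalois.tower_top_of_isGalois ℚ F M
  have h𝔮 : 𝔮 ≠ ⊥ := Ideal.ne_bot_of_liesOver_of_ne_bot h𝔭 𝔮
  let I := 𝔮.inertia Gal(M/ℚ)
  -- Multiplicativity of ramification indices in the tower ℚ ⊆ F ⊆ M.
  have h1 : Nat.card I = 𝔭.ramificationIdx ℤ * Nat.card (𝔮.inertia Gal(M/F)) := by
    rw [card_inertia_eq_ramificationIdx_int 𝔮 h𝔮, card_inertia_eq_ramificationIdx 𝔭 h𝔭 𝔮,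
      ← Ideal.ramificationIdx_tower]
  have h2 : Nat.card (MulAction.orbit I t) * Nat.card (MulAction.stabilizer I t) = Nat.card I := by
    rw [← Nat.card_prod]
    exact Nat.card_congr (MulAction.orbitProdStabilizerEquivGroup I t)
  have h3 : Nat.card (MulAction.orbit I t) ≤ e := by
    have hsub : MulAction.orbit I t ⊆ ((X ^ e - C (algebraMap ℚ M r) : M[X]).roots.toFinset) := by
      rintro _ ⟨σ, rfl⟩
      have : (σ : Gal(M/ℚ)) t ^ e = algebraMap ℚ M r := by
        rw [← map_pow, ht, AlgEquiv.commutes]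
      simp only [Finset.mem_coe, Multiset.mem_toFinset]
      rw [mem_roots (X_pow_sub_C_ne_zero (Nat.pos_of_ne_zero he) _)]
      rw [IsRoot.def, eval_sub, eval_pow, eval_X, eval_C, sub_eq_zero]
      exact this
    calc Nat.card (MulAction.orbit I t) = (MulAction.orbit I t).ncard := rfl
      _ ≤ _ := Set.ncard_le_ncard hsub (Finset.finite_toSet _)
      _ = _ := Set.ncard_coe_finset _
      _ ≤ _ := Multiset.toFinset_card_le _
      _ ≤ _ := card_roots' _
      _ = e := natDegree_X_pow_sub_C
  -- By `H` the stabilizer consists of `F`-automorphisms, so it embeds in the inertia group over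
  -- `F`.
  have h4 : Nat.card (MulAction.stabilizer I t) ≤ Nat.card (𝔮.inertia Gal(M/F)) := by
    let φ : MulAction.stabilizer I t → 𝔮.inertia Gal(M/F) := fun σ =>
      ⟨AlgEquiv.ofRingEquiv (f := ((σ : I) : Gal(M/ℚ)).toRingEquiv)
        (H _ (σ : I).2 (MulAction.mem_stabilizer_iff.mp σ.2)), fun x => (σ : I).2 x⟩
    refine Nat.card_le_card_of_injective φ fun σ τ h => ?_
    ext x
    exact congrArg (fun ρ : 𝔮.inertia Gal(M/F) => (ρ : Gal(M/F)) x) h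
  have h5 : 0 < Nat.card (𝔮.inertia Gal(M/F)) := Nat.card_pos
  refine Nat.le_of_mul_le_mul_right ?_ h5
  rw [← h1, ← h2]
  exact Nat.mul_le_mul h3 h4

open IsDedekindDomain in
/-- The elements of an inertia group are congruent to the identity on the integers of the
corresponding valuation. -/
lemma valuation_sub_lt_one_of_mem_inertia (v : HeightOneSpectrum (𝓞 M)) (σ : Gal(M/ℚ))
    (hσ : σ ∈ v.asIdeal.inertia Gal(M/ℚ)) (x : M) (hx : v.valuation M x ≤ 1) :
    v.valuation M (σ x - x) < 1 := by
  obtain ⟨a, b, hab⟩ := v.exists_primeCompl_mul_eq_of_integer x hx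
  have hmem : ∀ c : 𝓞 M, v.valuation M (σ (algebraMap (𝓞 M) M c) - algebraMap (𝓞 M) M c) < 1 := by
    intro c
    have : σ (algebraMap (𝓞 M) M c) - algebraMap (𝓞 M) M c =
        algebraMap (𝓞 M) M (σ • c - c) := by
      rw [map_sub]; rfl
    rw [this, v.valuation_lt_one_iff_mem]
    exact hσ c
  have hb : v.valuation M (algebraMap (𝓞 M) M b) = 1 := v.valuation_eq_one_iff_notMem.mpr b.2
  have hσb : v.valuation M (σ (algebraMap (𝓞 M) M b)) = 1 := by
    have := Valuation.map_add_eq_of_lt_left (v.valuation M)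
      ((hmem b).trans_eq hb.symm)
    rwa [add_sub_cancel, hb] at this
  have hσab : σ x * σ (algebraMap (𝓞 M) M b) = σ (algebraMap (𝓞 M) M a) := by
    rw [← map_mul, hab]
  -- Quotient rule for `x = a / b`, where `b` and `σ b` are units at `v`.
  have key : (σ x - x) * (σ (algebraMap (𝓞 M) M b) * algebraMap (𝓞 M) M b) =
      (σ (algebraMap (𝓞 M) M a) - algebraMap (𝓞 M) M a) * algebraMap (𝓞 M) M b -
      algebraMap (𝓞 M) M a * (σ (algebraMap (𝓞 M) M b) - algebraMap (𝓞 M) M b) := by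
    linear_combination (algebraMap (𝓞 M) M b) * hσab - σ (algebraMap (𝓞 M) M b) * hab
  have h1 := congrArg (v.valuation M) key
  rw [map_mul, map_mul, hb, hσb, mul_one, mul_one] at h1
  rw [h1]
  refine (Valuation.map_sub _ _ _).trans_lt (max_lt ?_ ?_)
  · rw [map_mul, hb, mul_one]
    exact hmem a
  · rw [map_mul]
    exact (mul_le_mul' (v.valuation_le_one a) le_rfl).trans_lt ((one_mul _).trans_lt (hmem b))

open IsDedekindDomain in
/-- The ramification bound for a number field that is fixed by every automorphism fixing a
solution of the equations `∑ a_j y_j ^ k = 0`, `1 ≤ k ≤ n - 1`, with `y_i = 1`. -/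
lemma ramificationIdx_le_of_powerSums [IsGalois ℚ M] {n : ℕ} (hn : 2 ≤ n) (a : Fin n → ℕ)
    (i : Fin n) (p h m : ℕ) (hpn : n < p) (hp : IsRegularPrime a i p)
    (ham : a i = p ^ h * m) (hm : Nat.Coprime p m) (hai : a i ≠ 0)
    (y : Fin n → M) (hyi : y i = 1)
    (hy : ∀ k, 1 ≤ k → k ≤ n - 1 → ∑ j, (a j : M) * y j ^ k = 0)
    (t : M) (ht : t ^ ((n - 1) / Nat.gcd (n - 1) h) = (p : M) ^ (h / Nat.gcd (n - 1) h))
    (H : ∀ σ : Gal(M/ℚ), (∀ j, σ (y j) = y j) →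
      ∀ x : F, σ (algebraMap F M x) = algebraMap F M x)
    (𝔭 : Ideal (𝓞 F)) [𝔭.IsMaximal] [𝔭.LiesOver (Ideal.span {(p : ℤ)})] :
    𝔭.ramificationIdx ℤ ≤ (n - 1) / Nat.gcd (n - 1) h := by
  classical
  have hp0 : (p : ℤ) ≠ 0 := by exact_mod_cast hp.1.ne_zero
  have h𝔭 : 𝔭 ≠ ⊥ := Ideal.ne_bot_of_liesOver_of_ne_bot
    (p := Ideal.span {(p : ℤ)}) (by simpa using hp.1.ne_zero) 𝔭
  obtain ⟨⟨𝔮, h𝔮, h𝔮𝔭⟩⟩ : Nonempty (𝔭.primesOver (𝓞 M)) := inferInstance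
  have h𝔮p : 𝔮.LiesOver (Ideal.span {(p : ℤ)}) := Ideal.LiesOver.trans 𝔮 𝔭 _
  let v : HeightOneSpectrum (𝓞 M) := ⟨𝔮, h𝔮, Ideal.ne_bot_of_liesOver_of_ne_bot h𝔭 𝔮⟩
  have hdpos : n - 1 ≠ 0 := by omega
  have hg : 0 < Nat.gcd (n - 1) h := Nat.gcd_pos_of_pos_left _ (by omega)
  have hvnat : ∀ k : ℕ, v.valuation M (k : M) < 1 ↔ p ∣ k := by
    intro k
    have h1 : (k : M) = algebraMap (𝓞 M) M (algebraMap ℤ (𝓞 M) k) := by simp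
    rw [h1, v.valuation_lt_one_iff_mem, ← Ideal.mem_comap]
    change (k : ℤ) ∈ 𝔮.under ℤ ↔ _
    rw [← h𝔮p.over, Ideal.mem_span_singleton, Int.natCast_dvd_natCast]
  have hvone : ∀ k : ℕ, ¬ p ∣ k → v.valuation M (k : M) = 1 := by
    intro k hk
    rw [← hvnat, not_lt] at hk
    exact le_antisymm (natCast_mem (v.valuation M).integer k) hk
  have hcard : (Finset.univ.erase i).card = n - 1 := by simp
  -- Only the valuation of `a i` matters, and it is that of `p ^ h`. The common factor of `n - 1`
  -- and `h` can therefore be cancelled in the equation of `t`, which is the source of the gcd in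
  -- the bound.
  have hvt : v.valuation M t ^ (n - 1) = v.valuation M (a i : M) := by
    have h1 := congrArg (v.valuation M) ht
    rw [map_pow, map_pow] at h1
    have h2 : n - 1 = (n - 1) / Nat.gcd (n - 1) h * Nat.gcd (n - 1) h :=
      (Nat.div_mul_cancel (Nat.gcd_dvd_left _ _)).symm
    have h3 : h = h / Nat.gcd (n - 1) h * Nat.gcd (n - 1) h :=
      (Nat.div_mul_cancel (Nat.gcd_dvd_right _ _)).symm
    calc v.valuation M t ^ (n - 1) =
          v.valuation M t ^ ((n - 1) / Nat.gcd (n - 1) h * Nat.gcd (n - 1) h) := by rw [← h2]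
      _ = v.valuation M p ^ (h / Nat.gcd (n - 1) h * Nat.gcd (n - 1) h) := by
          rw [pow_mul, h1, ← pow_mul]
      _ = v.valuation M p ^ h := by rw [← h3]
      _ = v.valuation M (a i : M) := by
          rw [ham]
          push_cast
          rw [map_mul, map_pow, hvone m, mul_one]
          exact (Nat.Prime.coprime_iff_not_dvd hp.1).mp hm
  refine ramificationIdx_le_of_inertia 𝔭 h𝔭 𝔮 t _
    (Nat.div_pos (Nat.le_of_dvd (by omega) (Nat.gcd_dvd_left _ _)) hg).ne'
    ((p : ℚ) ^ (h / Nat.gcd (n - 1) h)) (by rw [ht]; simp) fun σ hσ hσt => H σ ?_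
  -- Regularity makes the subset sums units, and `n < p` does the same for the exponents `k ≤ n -
  -- 1`.
  have main := map_eq_of_powerSums_eq (v.valuation M) (Finset.univ.erase i)
    (Finset.card_pos.mp (by omega)) a (a i) (fun S hS hne => hvone _ fun hdvd => hp.2.2 ?_)
    ((hvnat _).mpr hp.2.1) (by exact_mod_cast hai) (fun k hk1 hk2 => hvone _ fun hdvd => ?_) y
    (fun k hk1 hk2 => ?_) t (by rw [hcard, hvt]) σ.toRingHom
    (valuation_sub_lt_one_of_mem_inertia v σ hσ) hσt
  · intro j
    by_cases hj : j = i
    · rw [hj, hyi, map_one]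
    · exact main j (by simp [hj])
  · refine hdvd.trans (Finset.dvd_prod_of_mem (fun S => ∑ j ∈ S, a j) ?_)
    exact Finset.mem_erase.mpr ⟨hne.ne_empty, Finset.mem_powerset.mpr hS⟩
  · have := Nat.le_of_dvd hk1 hdvd
    omega
  · rw [eq_neg_iff_add_eq_zero, ← hy k hk1 (by omega),
      ← Finset.sum_erase_add _ _ (Finset.mem_univ i), hyi]
    simp

end Inertia

/-! ### Orders and multiplicities under automorphisms of the line -/

section Transport

variable {K : Type*} [Field K]

lemma algebraMap_ratFunc_ne_zero {p : K[X]} (hp : p ≠ 0) : algebraMap K[X] (RatFunc K) p ≠ 0 := by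
  rwa [Ne, map_eq_zero_iff _ (RatFunc.algebraMap_injective K)]

lemma ordAt_infty (f : RatFunc K) : ordAt f ∞ = -f.intDegree := rfl

lemma ordAt_coe (f : RatFunc K) (x : K) : ordAt f (x : OnePoint K) =
    (f.num.rootMultiplicity x : ℤ) - (f.denom.rootMultiplicity x : ℤ) := rfl

lemma ordAt_div_coe {p q : K[X]} (hp : p ≠ 0) (hq : q ≠ 0) (x : K) :
    ordAt (algebraMap K[X] (RatFunc K) p / algebraMap K[X] (RatFunc K) q) (x : OnePoint K) =
      (p.rootMultiplicity x : ℤ) - (q.rootMultiplicity x : ℤ) := by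
  set f := algebraMap K[X] (RatFunc K) p / algebraMap K[X] (RatFunc K) q with hf
  have hf0 : f ≠ 0 := div_ne_zero (algebraMap_ratFunc_ne_zero hp) (algebraMap_ratFunc_ne_zero hq)
  have h1 : f.num * q = p * f.denom := by
    apply RatFunc.algebraMap_injective K
    rw [map_mul, map_mul, ← div_eq_div_iff (algebraMap_ratFunc_ne_zero f.denom_ne_zero)
      (algebraMap_ratFunc_ne_zero hq), RatFunc.num_div_denom]
  have h2 := congrArg (rootMultiplicity x) h1
  rw [rootMultiplicity_mul (mul_ne_zero (RatFunc.num_ne_zero hf0) hq),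
    rootMultiplicity_mul (mul_ne_zero hp f.denom_ne_zero)] at h2
  rw [ordAt_coe]
  omega

lemma ordAt_algebraMap_coe {p : K[X]} (hp : p ≠ 0) (x : K) :
    ordAt (algebraMap K[X] (RatFunc K) p) (x : OnePoint K) = p.rootMultiplicity x := by
  have := ordAt_div_coe hp one_ne_zero x
  rwa [map_one, div_one, ← C_1, rootMultiplicity_C, Nat.cast_zero, sub_zero] at this

lemma ordAt_algebraMap_infty (p : K[X]) :
    ordAt (algebraMap K[X] (RatFunc K) p) ∞ = -(p.natDegree : ℤ) := by
  rw [ordAt_infty, RatFunc.intDegree_polynomial]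

lemma ordAt_mul {f g : RatFunc K} (hf : f ≠ 0) (hg : g ≠ 0) (P : OnePoint K) :
    ordAt (f * g) P = ordAt f P + ordAt g P := by
  induction P using OnePoint.rec with
  | infty => rw [ordAt_infty, ordAt_infty, ordAt_infty, RatFunc.intDegree_mul hf hg]; ring
  | coe x =>
    conv_lhs => rw [← RatFunc.num_div_denom f, ← RatFunc.num_div_denom g, div_mul_div_comm,
      ← map_mul, ← map_mul]
    have h1 := mul_ne_zero (RatFunc.num_ne_zero hf) (RatFunc.num_ne_zero hg)
    have h2 := mul_ne_zero f.denom_ne_zero g.denom_ne_zero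
    rw [ordAt_div_coe h1 h2, rootMultiplicity_mul h1, rootMultiplicity_mul h2, ordAt_coe, ordAt_coe]
    push_cast
    ring

lemma ordAt_div {f g : RatFunc K} (hf : f ≠ 0) (hg : g ≠ 0) (P : OnePoint K) :
    ordAt (f / g) P = ordAt f P - ordAt g P := by
  have := ordAt_mul (div_ne_zero hf hg) hg P
  rw [div_mul_cancel₀ _ hg] at this
  omega

lemma ordAt_C {c : K} (hc : c ≠ 0) (P : OnePoint K) : ordAt (RatFunc.C c) P = 0 := by
  have h : (RatFunc.C c : RatFunc K) = algebraMap K[X] (RatFunc K) (C c) := by simp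
  rw [h]
  induction P using OnePoint.rec with
  | infty => rw [ordAt_algebraMap_infty, natDegree_C, Nat.cast_zero, neg_zero]
  | coe x => rw [ordAt_algebraMap_coe (C_ne_zero.mpr hc), rootMultiplicity_C, Nat.cast_zero]

open Classical in
lemma ordAt_linear_coe {a b : K} (h : a ≠ 0 ∨ b ≠ 0) (x : K) :
    ordAt (RatFunc.C a * RatFunc.X + RatFunc.C b) (x : OnePoint K) =
      if a * x + b = 0 then 1 else 0 := by
  have h1 : RatFunc.C a * RatFunc.X + RatFunc.C b =
    algebraMap K[X] (RatFunc K) (C a * X + C b) := by simp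
  have h0 : C a * X + C b ≠ 0 := fun h2 => linear_ne_zero h (by rw [h1, h2, map_zero])
  rw [h1, ordAt_algebraMap_coe h0]
  split_ifs with hx
  · have ha : a ≠ 0 := by
      rintro rfl
      simp at h hx
      exact h hx
    have h2 : C a * X + C b = C a * (X - C x) := by
      rw [eq_neg_of_add_eq_zero_right hx]
      simp only [map_neg, map_mul]
      ring
    rw [h2, rootMultiplicity_mul (by rwa [← h2]), rootMultiplicity_C,
      rootMultiplicity_X_sub_C_self]
    simp
  · rw [rootMultiplicity_eq_zero]
    · simp
    · simpa [IsRoot] using hx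

open Classical in
lemma ordAt_linear_infty {a b : K} :
    ordAt (RatFunc.C a * RatFunc.X + RatFunc.C b) ∞ = if a = 0 then 0 else -1 := by
  have h1 : RatFunc.C a * RatFunc.X + RatFunc.C b =
    algebraMap K[X] (RatFunc K) (C a * X + C b) := by simp
  rw [h1, ordAt_algebraMap_infty]
  split_ifs with ha
  · simp [ha]
  · rw [natDegree_linear ha]; simp

open Classical in
-- This is the degree-one case of `ordAt_precomp`, to which the general case reduces by
-- factorization.
lemma ordAt_mobius_sub (g : GL (Fin 2) K) (r : K) (P : OnePoint K) :
    ordAt (mobius g - RatFunc.C r) P = ordAt (RatFunc.X - RatFunc.C r) (g • P) := by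
  have hdet := det_ne g
  have h1 : mobius g - RatFunc.C r =
      (RatFunc.C (g 0 0 - r * g 1 0) * RatFunc.X + RatFunc.C (g 0 1 - r * g 1 1)) /
      (RatFunc.C (g 1 0) * RatFunc.X + RatFunc.C (g 1 1)) := by
    rw [mobius, div_sub' (denom_ne g)]
    simp only [map_sub, map_mul]
    ring
  have h2 : (RatFunc.X - RatFunc.C r : RatFunc K) =
      RatFunc.C 1 * RatFunc.X + RatFunc.C (-r) := by
    simp [sub_eq_add_neg]
  have hn : g 0 0 - r * g 1 0 ≠ 0 ∨ g 0 1 - r * g 1 1 ≠ 0 := by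
    by_contra! h
    apply hdet
    linear_combination g 1 1 * h.1 - g 1 0 * h.2
  have hd : g 1 0 ≠ 0 ∨ g 1 1 ≠ 0 := by
    by_contra! h
    apply hdet
    rw [h.1, h.2]
    ring
  rw [h1, h2, ordAt_div (linear_ne_zero hn) (denom_ne g)]
  induction P using OnePoint.rec with
  | infty =>
    rw [ordAt_linear_infty, ordAt_linear_infty, OnePoint.smul_infty_eq_ite]
    by_cases h : g 1 0 = 0
    · have h0 : g 0 0 ≠ 0 := by
        intro h0
        apply hdet
        rw [h, h0]
        ring
      rw [if_pos h, if_pos h, ordAt_linear_infty, if_neg one_ne_zero, if_neg (by simpa [h] using h0)]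
      simp
    · rw [if_neg h, if_neg h, ordAt_linear_coe (Or.inl one_ne_zero)]
      have : 1 * (g 0 0 / g 1 0) + -r = 0 ↔ g 0 0 - r * g 1 0 = 0 := by
        rw [one_mul, ← sub_eq_add_neg, sub_eq_zero, div_eq_iff h, sub_eq_zero]
      simp only [this]
      split_ifs <;> simp
  | coe x =>
    rw [ordAt_linear_coe hn, ordAt_linear_coe hd, OnePoint.smul_some_eq_ite]
    by_cases h : g 1 0 * x + g 1 1 = 0
    · have h0 : (g 0 0 - r * g 1 0) * x + (g 0 1 - r * g 1 1) ≠ 0 := by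
        intro h0
        by_cases h10 : g 1 0 = 0
        · rw [h10] at h hdet
          simp at h
          apply hdet
          rw [h]
          ring
        · apply hdet
          have h3 : g 0 0 * x + g 0 1 = 0 := by linear_combination h0 + r * h
          linear_combination g 0 0 * h - g 1 0 * h3
      rw [if_neg h0, if_pos h, if_pos h, ordAt_linear_infty]
      simp
    · rw [if_neg h, if_neg h, ordAt_linear_coe (Or.inl one_ne_zero)]
      have : 1 * ((g 0 0 * x + g 0 1) / (g 1 0 * x + g 1 1)) + -r = 0 ↔
          (g 0 0 - r * g 1 0) * x + (g 0 1 - r * g 1 1) = 0 := by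
        rw [one_mul, ← sub_eq_add_neg, sub_eq_zero, div_eq_iff h, ← sub_eq_zero]
        ring_nf
      simp only [this]
      simp

open Classical in
/-- The group of automorphisms of the projective line is transitive on triples. -/
lemma exists_smul_eq_triple {P Q R : OnePoint K} (hPQ : P ≠ Q) (hPR : P ≠ R) (hQR : Q ≠ R) :
    ∃ g : GL (Fin 2) K, g • (∞ : OnePoint K) = P ∧ g • ((0 : K) : OnePoint K) = Q ∧
      g • ((1 : K) : OnePoint K) = R := by
  obtain ⟨g₁, hg₁⟩ : ∃ g : GL (Fin 2) K, g • (∞ : OnePoint K) = P := by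
    induction P using OnePoint.rec with
    | infty => exact ⟨1, one_smul _ _⟩
    | coe c =>
      refine ⟨Matrix.GeneralLinearGroup.mkOfDetNeZero !![c, 1; 1, 0] (by simp), ?_⟩
      simp [OnePoint.smul_infty_eq_ite, Matrix.GeneralLinearGroup.mkOfDetNeZero]
  obtain ⟨w, hw⟩ : ∃ w : K, g₁ • (w : OnePoint K) = Q := by
    obtain ⟨w, hw⟩ := OnePoint.ne_infty_iff_exists.mp
      (show g₁⁻¹ • Q ≠ ∞ from fun h => hPQ (by rw [← hg₁, ← h, smul_inv_smul]))
    exact ⟨w, by rw [hw, smul_inv_smul]⟩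
  obtain ⟨z, hz⟩ : ∃ z : K, g₁ • (z : OnePoint K) = R := by
    obtain ⟨w, hw⟩ := OnePoint.ne_infty_iff_exists.mp
      (show g₁⁻¹ • R ≠ ∞ from fun h => hPR (by rw [← hg₁, ← h, smul_inv_smul]))
    exact ⟨w, by rw [hw, smul_inv_smul]⟩
  have hwz : z - w ≠ 0 := fun h => hQR (by rw [← hw, ← hz, sub_eq_zero.mp h])
  -- The affine map fixing ∞ and sending 0 to `w` and 1 to `z`.
  let g₂ : GL (Fin 2) K := Matrix.GeneralLinearGroup.mkOfDetNeZero !![z - w, w; 0, 1] (by simpa)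
  refine ⟨g₁ * g₂, ?_, ?_, ?_⟩
  · rw [mul_smul, show g₂ • (∞ : OnePoint K) = ∞ by
      simp [g₂, OnePoint.smul_infty_eq_ite, Matrix.GeneralLinearGroup.mkOfDetNeZero], hg₁]
  · rw [mul_smul, show g₂ • ((0 : K) : OnePoint K) = (w : OnePoint K) by
      simp [g₂, OnePoint.smul_some_eq_ite, Matrix.GeneralLinearGroup.mkOfDetNeZero], hw]
  · rw [mul_smul, show g₂ • ((1 : K) : OnePoint K) = (z : OnePoint K) by
      simp [g₂, OnePoint.smul_some_eq_ite, Matrix.GeneralLinearGroup.mkOfDetNeZero], hz]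

variable [IsAlgClosed K]

open Classical in
-- Both sides are additive in `f`, and over an algebraically closed field numerator and denominator
-- split into constants and linear factors.
lemma ordAt_precomp {f : RatFunc K} (hf : f ≠ 0) (g : GL (Fin 2) K) (P : OnePoint K) :
    ordAt (precomp f g) P = ordAt f (g • P) := by
  have hpoly : ∀ p : K[X], p ≠ 0 → ordAt (precompHom g (algebraMap K[X] (RatFunc K) p)) P =
      ordAt (algebraMap K[X] (RatFunc K) p) (g • P) := by
    intro p hp
    have hs := (IsAlgClosed.splits p).eq_prod_roots
    have hne : ∀ s : Multiset K, (s.map fun x => X - C x).prod ≠ 0 := fun s =>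
      (monic_multiset_prod_of_monic _ _ fun x _ => monic_X_sub_C x).ne_zero
    have hroots : ∀ s : Multiset K, ordAt (precompHom g (algebraMap K[X] (RatFunc K)
        (s.map fun x => X - C x).prod)) P =
        ordAt (algebraMap K[X] (RatFunc K) (s.map fun x => X - C x).prod) (g • P) := by
      intro s
      induction s using Multiset.induction with
      | empty =>
        have := ordAt_C (one_ne_zero (α := K))
        simp only [map_one] at this
        simp [this]
      | cons x s ih =>
        have h1 := algebraMap_ratFunc_ne_zero (X_sub_C_ne_zero x)
        have h2 := algebraMap_ratFunc_ne_zero (hne s)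
        rw [Multiset.map_cons, Multiset.prod_cons, map_mul, map_mul, ordAt_mul h1 h2,
          ordAt_mul ((_root_.map_ne_zero _).mpr h1) ((_root_.map_ne_zero _).mpr h2), ih]
        congr 1
        rw [map_sub, RatFunc.algebraMap_X, RatFunc.algebraMap_C, map_sub, precompHom_X,
          precompHom_C, ordAt_mobius_sub]
    have hlc : p.leadingCoeff ≠ 0 := leadingCoeff_ne_zero.mpr hp
    have h1 : (RatFunc.C p.leadingCoeff : RatFunc K) ≠ 0 := by simpa using hlc
    have h2 := algebraMap_ratFunc_ne_zero (hne p.roots)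
    rw [hs, map_mul, map_mul, RatFunc.algebraMap_C, ordAt_mul h1 h2,
      ordAt_mul ((_root_.map_ne_zero _).mpr h1) ((_root_.map_ne_zero _).mpr h2), hroots,
      precompHom_C, ordAt_C hlc, ordAt_C hlc]
  have hn := RatFunc.num_ne_zero hf
  have hd := f.denom_ne_zero
  rw [precomp_eq]
  conv_lhs => rw [← RatFunc.num_div_denom f]
  conv_rhs => rw [← RatFunc.num_div_denom f]
  rw [map_div₀, ordAt_div (algebraMap_ratFunc_ne_zero hn) (algebraMap_ratFunc_ne_zero hd),
    ordAt_div ((_root_.map_ne_zero _).mpr (algebraMap_ratFunc_ne_zero hn))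
      ((_root_.map_ne_zero _).mpr (algebraMap_ratFunc_ne_zero hd)), hpoly _ hn, hpoly _ hd]

open Classical in
lemma mult_precomp {f : RatFunc K} (hf : ∀ c : K, f ≠ RatFunc.C c) (g : GL (Fin 2) K)
    (P Q : OnePoint K) : mult (precomp f g) P Q = mult f (g • P) Q := by
  induction Q using OnePoint.rec with
  | infty =>
    have hf0 : f ≠ 0 := by simpa using hf 0
    simp only [mult, OnePoint.elim_infty, ordAt_precomp hf0]
  | coe c =>
    have h1 : precomp f g - RatFunc.C c = precomp (f - RatFunc.C c) g := by
      rw [precomp_eq, precomp_eq, map_sub, precompHom_C]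
    simp only [mult, OnePoint.elim_some, h1, ordAt_precomp (sub_ne_zero.mpr (hf c))]

open Classical in
lemma IsCover.precomp {n : ℕ} {a : Fin n → ℕ} {f : RatFunc K} (hf : IsCover a f)
    (g : GL (Fin 2) K) : IsCover a (precomp f g) := by
  have hm := mult_precomp hf.nonconstant g
  have hfib : ∀ P Q, P ∈ fiber (DiameterFour.precomp f g) Q ↔ g • P ∈ fiber f Q := fun P Q => by
    simp only [fiber, Set.mem_ofPred_eq, hm]
  refine ⟨fun c hc => hf.nonconstant c ?_, fun Q h0 h1 hi P hP => ?_, fun P Q hP => ?_, ?_, ?_, ?_⟩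
  · rw [precomp_eq, ← precompHom_C g c] at hc
    exact (precompHom g).toRingHom.injective hc
  · rw [hm]
    exact hf.etale Q h0 h1 hi _ ((hfib P Q).mp hP)
  · rw [hm]
    exact hf.tame _ Q ((hfib P Q).mp hP)
  · obtain ⟨P, hP, hu⟩ := hf.totally_ramified
    refine ⟨g⁻¹ • P, (hfib _ _).mpr (by rwa [smul_inv_smul]), fun P' hP' => ?_⟩
    rw [← hu _ ((hfib _ _).mp hP'), inv_smul_smul]
  · obtain ⟨x, hx, hr, hxm⟩ := hf.fiber_zero
    refine ⟨fun j => g⁻¹ • x j, (MulAction.injective g⁻¹).comp hx, ?_, fun j => ?_⟩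
    · ext P
      rw [hfib, ← hr]
      simp only [Set.mem_range, inv_smul_eq_iff]
    · rw [hm, smul_inv_smul, hxm]
  · obtain ⟨P, hP, hu⟩ := hf.fiber_one
    refine ⟨g⁻¹ • P, ?_, fun P' hP' => ?_⟩
    · beta_reduce
      rw [hfib, hm, smul_inv_smul]
      exact hP
    · beta_reduce at hP'
      rw [hfib, hm] at hP'
      rw [← hu _ hP', inv_smul_smul]

end Transport

/-! ### Normalized coverings as polynomials -/

section Normalized

variable {K : Type*} [Field K]

lemma mult_algebraMap_coe {F : K[X]} {c : K} (hF : F ≠ C c) (x : K) :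
    mult (algebraMap K[X] (RatFunc K) F) (x : OnePoint K) (c : OnePoint K) =
      (F - C c).rootMultiplicity x := by
  have h : algebraMap K[X] (RatFunc K) F - RatFunc.C c = algebraMap K[X] (RatFunc K) (F - C c) := by
    rw [map_sub, RatFunc.algebraMap_C]
  rw [mult, OnePoint.elim_some, h, ordAt_algebraMap_coe (sub_ne_zero.mpr hF), Int.toNat_natCast]

lemma mult_algebraMap_infty (F : K[X]) (c : K) :
    mult (algebraMap K[X] (RatFunc K) F) ∞ (c : OnePoint K) = 0 := by
  have h : algebraMap K[X] (RatFunc K) F - RatFunc.C c = algebraMap K[X] (RatFunc K) (F - C c) := by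
    rw [map_sub, RatFunc.algebraMap_C]
  rw [mult, OnePoint.elim_some, h, ordAt_algebraMap_infty]
  omega

variable [IsAlgClosed K]

/-- A rational function without finite poles is a polynomial. -/
lemma eq_algebraMap_num {f : RatFunc K} (hf : ∀ x : K, (x : OnePoint K) ∉ fiber f ∞) :
    f = algebraMap K[X] (RatFunc K) f.num := by
  have hdeg : f.denom.degree = 0 := by
    by_contra hne
    obtain ⟨x, hx⟩ := IsAlgClosed.exists_root f.denom hne
    have hnum : ¬ f.num.IsRoot x := fun h => by
      obtain ⟨u, w, huw⟩ := f.isCoprime_num_denom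
      have := congrArg (Polynomial.eval x) huw
      simp [IsRoot.def.mp h, IsRoot.def.mp hx] at this
    apply hf x
    have h1 := (rootMultiplicity_pos f.denom_ne_zero).mpr hx
    have h2 := rootMultiplicity_eq_zero hnum
    change 0 < (-ordAt f (x : OnePoint K)).toNat
    rw [ordAt_coe, h2]
    omega
  have hone : f.denom = 1 := by
    rw [eq_C_of_degree_eq_zero hdeg]
    have := f.monic_denom
    rw [eq_C_of_degree_eq_zero hdeg, Monic, leadingCoeff_C] at this
    rw [this, C_1]
  conv_lhs => rw [← RatFunc.num_div_denom f, hone, map_one, div_one]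

variable [CharZero K]

/-- Riemann–Hurwitz by hand: `F'` has degree `∑ a_j - 1`, and away from 0 its only possible zeros
are the `ξ_j`, of order `a_j - 1`. The remaining `n - 1` zeros are all at the origin. -/
lemma exists_polynomial_of_normalized {n : ℕ} {a : Fin n → ℕ} {f : RatFunc K} (hf : IsCover a f)
    (hinf : ∞ ∈ fiber f ∞)
    (h0 : ((0 : K) : OnePoint K) ∈ fiber f ((1 : K) : OnePoint K) ∧
      1 < mult f ((0 : K) : OnePoint K) ((1 : K) : OnePoint K))
    (x : Fin n → OnePoint K) (hx : Function.Injective x)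
    (hr : Set.range x = fiber f ((0 : K) : OnePoint K))
    (hm : ∀ j, mult f (x j) ((0 : K) : OnePoint K) = a j) :
    ∃ (F : K[X]) (ξ : Fin n → K), f = algebraMap K[X] (RatFunc K) F ∧ (∀ j, x j = ξ j) ∧
      (∀ j, ξ j ≠ 0) ∧ (∀ j, a j ≠ 0) ∧
      F = C F.leadingCoeff * ∏ j, (X - C (ξ j)) ^ a j ∧ F.eval 0 = 1 ∧
      X ^ (n - 1) ∣ derivative F ∧ 2 ≤ n := by
  classical
  have hpole : ∀ x : K, (x : OnePoint K) ∉ fiber f ∞ := fun x hx =>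
    OnePoint.coe_ne_infty x (hf.totally_ramified.unique hx hinf)
  obtain ⟨F, hF⟩ : ∃ F, f = algebraMap K[X] (RatFunc K) F := ⟨_, eq_algebraMap_num hpole⟩
  subst hF
  have hFC : ∀ c, F ≠ C c := fun c h => hf.nonconstant c (by rw [h, RatFunc.algebraMap_C])
  have hF0 : F ≠ 0 := by simpa using hFC 0
  have hxfin : ∀ j, ∃ z : K, (z : OnePoint K) = x j := fun j => by
    refine OnePoint.ne_infty_iff_exists.mp fun h => ?_
    have h1 : x j ∈ fiber (algebraMap K[X] (RatFunc K) F) ((0 : K) : OnePoint K) :=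
      hr ▸ Set.mem_range_self j
    have h2 : 0 < mult (algebraMap K[X] (RatFunc K) F) (x j) ((0 : K) : OnePoint K) := h1
    rw [h, mult_algebraMap_infty] at h2
    exact lt_irrefl _ h2
  choose ξ hξ using hxfin
  have hξinj : Function.Injective ξ := fun j l h => hx (by rw [← hξ, ← hξ, h])
  have hmem : ∀ z c : K, (z : OnePoint K) ∈ fiber (algebraMap K[X] (RatFunc K) F)
      ((c : K) : OnePoint K) ↔ F.eval z = c := by
    intro z c
    change 0 < mult _ _ _ ↔ _
    rw [mult_algebraMap_coe (hFC c), rootMultiplicity_pos (sub_ne_zero.mpr (hFC c)), IsRoot.def,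
      eval_sub, eval_C, sub_eq_zero]
  have hroot : ∀ z, F.eval z = 0 ↔ z ∈ Finset.univ.image ξ := by
    intro z
    rw [← hmem, ← hr]
    simp only [Set.mem_range, ← hξ, OnePoint.coe_eq_coe, Finset.mem_image, Finset.mem_univ,
      true_and]
  have hmξ : ∀ j, F.rootMultiplicity (ξ j) = a j := by
    intro j
    rw [← hm j, ← hξ, mult_algebraMap_coe (hFC 0), C_0, sub_zero]
  have haj : ∀ j, a j ≠ 0 := by
    intro j
    rw [← hmξ j]
    exact ((rootMultiplicity_pos hF0).mpr ((hroot _).mpr (by simp))).ne'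
  have hroots : F.roots.toFinset = Finset.univ.image ξ := by
    ext z
    rw [Multiset.mem_toFinset, mem_roots hF0, IsRoot.def, hroot]
  have hprod : F = C F.leadingCoeff * ∏ j, (X - C (ξ j)) ^ a j := by
    conv_lhs => rw [(IsAlgClosed.splits F).eq_prod_roots]
    rw [Finset.prod_multiset_map_count, hroots, Finset.prod_image (hξinj.injOn)]
    simp only [count_roots, hmξ]
  have hdegF : F.natDegree = ∑ j, a j := by
    rw [(IsAlgClosed.splits F).natDegree_eq_card_roots, ← Multiset.toFinset_sum_count_eq, hroots,
      Finset.sum_image (hξinj.injOn)]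
    simp only [count_roots, hmξ]
  have hF01 : F.eval 0 = 1 := (hmem 0 1).mp h0.1
  have hξ0 : ∀ j, ξ j ≠ 0 := by
    intro j hj
    have := (hroot (ξ j)).mpr (by simp)
    rw [hj, hF01] at this
    exact one_ne_zero this
  have hdF : derivative F ≠ 0 := by
    intro h
    exact hFC _ (eq_C_of_derivative_eq_zero h)
  have hcrit : ∀ z, (derivative F).rootMultiplicity z = (F - C (F.eval z)).rootMultiplicity z - 1 := by
    intro z
    rw [← derivative_rootMultiplicity_of_root (by simp), derivative_sub, derivative_C, sub_zero]
  have hcrit' : ∀ z, z ≠ 0 → F.eval z ≠ 0 → (derivative F).rootMultiplicity z = 0 := by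
    intro z hz hFz
    rw [hcrit, ← mult_algebraMap_coe (hFC _)]
    by_cases h1 : F.eval z = 1
    · rw [h1]
      by_contra hne
      apply hz
      have := hf.fiber_one.unique (y₁ := (z : OnePoint K)) ⟨(hmem _ _).mpr h1, by omega⟩ h0
      exact OnePoint.coe_injective this
    · rw [hf.etale _ (by simpa using hFz) (by simpa using h1) (OnePoint.coe_ne_infty _) _
        ((hmem _ _).mpr rfl)]
  have hsub : (derivative F).roots.toFinset ⊆ insert 0 (Finset.univ.image ξ) := by
    intro z hz
    rw [Multiset.mem_toFinset, mem_roots hdF] at hz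
    rw [Finset.mem_insert, ← hroot]
    by_contra! hcon
    exact ((rootMultiplicity_pos hdF).mpr hz).ne' (hcrit' z hcon.1 hcon.2)
  have hcount : (derivative F).natDegree = (derivative F).rootMultiplicity 0 + ∑ j, (a j - 1) := by
    rw [(IsAlgClosed.splits (derivative F)).natDegree_eq_card_roots,
      ← Multiset.sum_count_eq_card (s := insert 0 (Finset.univ.image ξ))
        (fun z hz => hsub (Multiset.mem_toFinset.mpr hz)), Finset.sum_insert,
      Finset.sum_image (hξinj.injOn)]
    · simp only [count_roots]
      congr 1
      refine Finset.sum_congr rfl fun j _ => ?_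
      rw [hcrit, (hroot _).mpr (by simp), C_0, sub_zero, hmξ]
    · simp only [Finset.mem_image, Finset.mem_univ, true_and, not_exists]
      exact hξ0
  have hdd : (derivative F).natDegree = F.natDegree - 1 := natDegree_derivative F
  have hsum : ∑ j, (a j - 1) + n = ∑ j, a j := by
    have : ∑ j, (a j - 1) + ∑ j : Fin n, 1 = ∑ j, a j := by
      rw [← Finset.sum_add_distrib]
      exact Finset.sum_congr rfl fun j _ => by have := haj j; omega
    simpa using this
  have hdeg0 : F.natDegree ≠ 0 := fun h => hFC _ (eq_C_of_natDegree_eq_zero h)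
  have hrm : (derivative F).rootMultiplicity 0 = n - 1 := by omega
  -- The point 0 is ramified, which forces `n ≥ 2`.
  have hrm2 : 1 ≤ (derivative F).rootMultiplicity 0 := by
    have := h0.2
    rw [mult_algebraMap_coe (hFC _)] at this
    rw [hcrit, hF01]
    omega
  refine ⟨F, ξ, rfl, fun j => (hξ j).symm, hξ0, haj, hprod, hF01, ?_, by omega⟩
  have := pow_rootMultiplicity_dvd (derivative F) 0
  rwa [C_0, sub_zero, hrm] at this

end Normalized

/-! ### Logarithmic derivatives as power series -/

section LogarithmicDerivative

variable {K : Type*} [Field K]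

lemma X_sub_C_mul_mk {z : K} (hz : z ≠ 0) :
    ((X - C z : K[X]) : PowerSeries K) * (PowerSeries.mk fun k => -z⁻¹ ^ (k + 1)) = 1 := by
  ext k
  rw [coe_sub, coe_X, coe_C, sub_mul, map_sub, PowerSeries.coeff_C_mul, PowerSeries.coeff_mk]
  rcases k with _ | k
  · simp [hz]
  · rw [PowerSeries.coeff_succ_X_mul, PowerSeries.coeff_mk, PowerSeries.coeff_one,
      if_neg (Nat.succ_ne_zero k), pow_succ _ (k + 1)]
    field_simp
    ring

/-- The identity P'/P = ∑ a_j/(X - ξ_j) with denominators cleared, each 1/(X - ξ_j) being the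
geometric series of `X_sub_C_mul_mk`. -/
lemma derivative_prod_eq_mul_sum {ι : Type*} (s : Finset ι) (a : ι → ℕ) (ξ : ι → K)
    (hξ : ∀ j ∈ s, ξ j ≠ 0) :
    ((derivative (∏ j ∈ s, (X - C (ξ j)) ^ a j) : K[X]) : PowerSeries K) =
      ((∏ j ∈ s, (X - C (ξ j)) ^ a j : K[X]) : PowerSeries K) *
        ∑ j ∈ s, (a j : PowerSeries K) * PowerSeries.mk fun k => -(ξ j)⁻¹ ^ (k + 1) := by
  classical
  induction s using Finset.induction with
  | empty => simp
  | insert i s hi ih =>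
    have h1 := X_sub_C_mul_mk (hξ i (Finset.mem_insert_self _ _))
    have ih := ih fun j hj => hξ j (Finset.mem_insert_of_mem hj)
    rw [Finset.prod_insert hi, Finset.sum_insert hi, derivative_mul, derivative_X_sub_C_pow]
    simp only [Polynomial.coe_add, Polynomial.coe_mul]
    rw [ih]
    have h2 : ((C (a i : K) * (X - C (ξ i)) ^ (a i - 1) : K[X]) : PowerSeries K) =
        (((X - C (ξ i)) ^ a i : K[X]) : PowerSeries K) * ((a i : PowerSeries K) *
          PowerSeries.mk fun k => -(ξ i)⁻¹ ^ (k + 1)) := by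
      rcases hk : a i with _ | k
      · simp
      · simp only [Polynomial.coe_mul, Polynomial.coe_pow, add_tsub_cancel_right, map_natCast]
        rw [pow_succ]
        have h3 : (((k + 1 : ℕ) : K[X]) : PowerSeries K) = ((k + 1 : ℕ) : PowerSeries K) :=
          map_natCast (Polynomial.coeToPowerSeries.ringHom (R := K)) _
        rw [h3]
        linear_combination (-(((k + 1 : ℕ) : PowerSeries K) *
          ((X - C (ξ i) : K[X]) : PowerSeries K) ^ k)) * h1
    rw [← Polynomial.coe_mul, h2]
    ring

/-- The vanishing of the derivative of `∏ (X - ξ_j) ^ a_j` at the origin, in terms of weighted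
power sums. -/
lemma sum_mul_inv_pow_eq_zero {ι : Type*} [Fintype ι] (a : ι → ℕ) (ξ : ι → K)
    (hξ : ∀ j, ξ j ≠ 0) (m : ℕ) (h : X ^ m ∣ derivative (∏ j, (X - C (ξ j)) ^ a j)) (k : ℕ)
    (hk1 : 1 ≤ k) (hk : k ≤ m) : ∑ j, (a j : K) * (ξ j)⁻¹ ^ k = 0 := by
  obtain ⟨q, hq⟩ := h
  have h1 := derivative_prod_eq_mul_sum Finset.univ a ξ fun j _ => hξ j
  -- The product has non-zero constant term, so the order of vanishing of P' at 0 is that of P'/P.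
  have hu : IsUnit ((∏ j, (X - C (ξ j)) ^ a j : K[X]) : PowerSeries K) := by
    rw [PowerSeries.isUnit_iff_constantCoeff, Polynomial.constantCoeff_coe,
      coeff_zero_eq_eval_zero, eval_prod, isUnit_iff_ne_zero]
    exact Finset.prod_ne_zero_iff.mpr fun j _ => by simp [hξ j]
  have h2 : (PowerSeries.X : PowerSeries K) ^ m ∣ ∑ j, (a j : PowerSeries K) *
      PowerSeries.mk fun k => -(ξ j)⁻¹ ^ (k + 1) := by
    rw [← hu.dvd_mul_left, ← h1, hq]
    exact ⟨(q : PowerSeries K), by simp⟩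
  -- The `k`-th power sum is, up to sign, the coefficient of degree `k - 1`.
  have h3 := PowerSeries.X_pow_dvd_iff.mp h2 (k - 1) (by omega)
  rw [map_sum] at h3
  rw [← neg_eq_zero, ← h3, ← Finset.sum_neg_distrib]
  refine Finset.sum_congr rfl fun j _ => ?_
  rw [← map_natCast (PowerSeries.C (R := K)), PowerSeries.coeff_C_mul, PowerSeries.coeff_mk,
    Nat.sub_add_cancel hk1]
  ring

end LogarithmicDerivative

/-! ### Galois conjugates of coverings -/

section Conjugation

variable {K : Type*} [Field K]

/-- The action of an automorphism on the coefficients, as an endomorphism of the function field. -/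
def conjHom (σ : K ≃+* K) : RatFunc K →+* RatFunc K :=
  RatFunc.mapRingHom (Polynomial.mapRingHom (σ : K →+* K)) (by
    intro p hp
    rw [Submonoid.mem_comap, mem_nonZeroDivisors_iff_ne_zero]
    exact (Polynomial.map_ne_zero_iff σ.injective).mpr (nonZeroDivisors.ne_zero hp))

lemma conjHom_algebraMap (σ : K ≃+* K) (p : K[X]) :
    conjHom σ (algebraMap K[X] (RatFunc K) p) =
      algebraMap K[X] (RatFunc K) (p.map (σ : K →+* K)) := by
  have := RatFunc.map_apply_div (Polynomial.mapRingHom (σ : K →+* K)) (by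
    intro p hp
    rw [Submonoid.mem_comap, mem_nonZeroDivisors_iff_ne_zero]
    exact (Polynomial.map_ne_zero_iff σ.injective).mpr (nonZeroDivisors.ne_zero hp)) p 1
  simp only [map_one, div_one] at this
  exact this

lemma conj_eq_conjHom (σ : K ≃+* K) (f : RatFunc K) : conj σ f = conjHom σ f := by
  conv_rhs => rw [← RatFunc.num_div_denom f]
  rw [map_div₀, conjHom_algebraMap, conjHom_algebraMap, conj]

lemma conjHom_C (σ : K ≃+* K) (c : K) : conjHom σ (RatFunc.C c) = RatFunc.C (σ c) := by
  rw [← RatFunc.algebraMap_C, conjHom_algebraMap, map_C, RatFunc.algebraMap_C]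
  rfl

lemma conjHom_mobius (σ : K ≃+* K) (g : GL (Fin 2) K) :
    conjHom σ (mobius g) = mobius (Matrix.GeneralLinearGroup.map (σ : K →+* K) g) := by
  have hX : conjHom σ RatFunc.X = RatFunc.X := by
    rw [← RatFunc.algebraMap_X, conjHom_algebraMap, map_X]
  simp [mobius, conjHom_C, hX]

lemma precomp_algebraMap (F : K[X]) (g : GL (Fin 2) K) :
    precomp (algebraMap K[X] (RatFunc K) F) g = aeval (mobius g) F := by
  have := precomp_div F 1 g one_ne_zero
  simpa using this

/-- A covering isomorphic to a polynomial with coefficients fixed by `σ` is isomorphic to its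
conjugate by `σ`. -/
lemma isomorphic_conj {f : RatFunc K} {g : GL (Fin 2) K} {F : K[X]} (σ : K ≃+* K)
    (hF : precomp f g = algebraMap K[X] (RatFunc K) F) (hσ : F.map (σ : K →+* K) = F) :
    Isomorphic f (conj σ f) := by
  have hf : f = precomp (algebraMap K[X] (RatFunc K) F) g⁻¹ := by
    rw [← hF, precomp_precomp, mul_inv_cancel, precomp_one]
  -- From f = F ∘ g⁻¹ one gets σf = F ∘ σ(g⁻¹) = f ∘ (g σ(g⁻¹)).
  refine ⟨g * Matrix.GeneralLinearGroup.map (σ : K →+* K) g⁻¹, ?_⟩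
  rw [← precomp_precomp, hF, precomp_algebraMap, conj_eq_conjHom]
  conv_lhs => rw [hf, precomp_algebraMap, aeval_def, hom_eval₂, conjHom_mobius]
  conv_rhs => rw [← hσ, aeval_def, eval₂_map]
  congr 1
  ext1 c
  exact conjHom_C σ c

end Conjugation

/-! ### Disjointness of fibres -/

section Fibers

variable {K : Type*} [Field K]

lemma min_ordAt_le_ordAt_add {f g : RatFunc K} (hf : f ≠ 0) (hg : g ≠ 0) (hfg : f + g ≠ 0)
    (P : OnePoint K) : min (ordAt f P) (ordAt g P) ≤ ordAt (f + g) P := by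
  induction P using OnePoint.rec with
  | infty =>
    have := RatFunc.intDegree_add_le hg hfg
    rw [ordAt_infty, ordAt_infty, ordAt_infty]
    omega
  | coe x =>
    have hfd := f.denom_ne_zero
    have hgd := g.denom_ne_zero
    have h1 : f + g = algebraMap K[X] (RatFunc K) (f.num * g.denom + f.denom * g.num) /
        algebraMap K[X] (RatFunc K) (f.denom * g.denom) := by
      conv_lhs => rw [← RatFunc.num_div_denom f, ← RatFunc.num_div_denom g,
        div_add_div _ _ (algebraMap_ratFunc_ne_zero hfd) (algebraMap_ratFunc_ne_zero hgd)]
      simp only [map_add, map_mul]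
    have h2 : f.num * g.denom + f.denom * g.num ≠ 0 := by
      intro h2
      rw [h2, map_zero, zero_div] at h1
      exact hfg h1
    have h3 := rootMultiplicity_add x h2
    rw [rootMultiplicity_mul (mul_ne_zero (RatFunc.num_ne_zero hf) hgd),
      rootMultiplicity_mul (mul_ne_zero hfd (RatFunc.num_ne_zero hg))] at h3
    rw [h1, ordAt_div_coe h2 (mul_ne_zero hfd hgd), rootMultiplicity_mul (mul_ne_zero hfd hgd),
      ordAt_coe, ordAt_coe]
    omega

/-- Otherwise the non-zero constant `d - c`, a difference of two functions vanishing at `P`, would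
vanish there too. With `notMem_fiber_infty` this makes the three normalized points distinct. -/
lemma eq_of_mem_fiber {f : RatFunc K} (hf : ∀ c, f ≠ RatFunc.C c) {P : OnePoint K} {c d : K}
    (hc : P ∈ fiber f (c : OnePoint K)) (hd : P ∈ fiber f (d : OnePoint K)) : c = d := by
  by_contra hne
  have hc' : 0 < ordAt (f - RatFunc.C c) P := Int.pos_iff_toNat_pos.mpr hc
  have hd' : 0 < ordAt (f - RatFunc.C d) P := Int.pos_iff_toNat_pos.mpr hd
  have h0 : (-1 : K) ≠ 0 := neg_ne_zero.mpr one_ne_zero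
  have h1 : (f - RatFunc.C c) + RatFunc.C (-1) * (f - RatFunc.C d) = RatFunc.C (d - c) := by
    simp only [map_neg, map_one, map_sub]
    ring
  have h2 : d - c ≠ 0 := sub_ne_zero.mpr (Ne.symm hne)
  have hC : ∀ {e : K}, e ≠ 0 → (RatFunc.C e : RatFunc K) ≠ 0 := fun he => by simpa using he
  have h3 := min_ordAt_le_ordAt_add (sub_ne_zero.mpr (hf c))
    (mul_ne_zero (hC h0) (sub_ne_zero.mpr (hf d))) (by rw [h1]; exact hC h2) P
  rw [h1, ordAt_mul (hC h0) (sub_ne_zero.mpr (hf d)), ordAt_C h0, ordAt_C h2] at h3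
  omega

lemma notMem_fiber_infty {f : RatFunc K} (hf : ∀ c, f ≠ RatFunc.C c) {P : OnePoint K} {c : K}
    (hc : P ∈ fiber f (c : OnePoint K)) : P ∉ fiber f ∞ := by
  intro hi
  have hc' : 0 < ordAt (f - RatFunc.C c) P := Int.pos_iff_toNat_pos.mpr hc
  have hi' : 0 < -ordAt f P := Int.pos_iff_toNat_pos.mpr hi
  by_cases h0 : c = 0
  · rw [h0, map_zero, sub_zero] at hc'
    omega
  · have hf0 : f ≠ 0 := by simpa using hf 0
    have h3 := min_ordAt_le_ordAt_add (sub_ne_zero.mpr (hf c))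
      (show (RatFunc.C c : RatFunc K) ≠ 0 by simpa using h0) (by rwa [sub_add_cancel]) P
    rw [sub_add_cancel, ordAt_C h0] at h3
    omega

end Fibers

/-! ### The field of moduli and the final bound -/

section FieldOfModuli

lemma exists_powerSums_of_isCover {K : Type*} [Field K] [IsAlgClosed K] [CharZero K] {n : ℕ}
    {a : Fin n → ℕ} {f : RatFunc K} (hf : IsCover a f) (i : Fin n) :
    2 ≤ n ∧ (∀ j, a j ≠ 0) ∧ ∃ y : Fin n → K, y i = 1 ∧
      (∀ k, 1 ≤ k → k ≤ n - 1 → ∑ j, (a j : K) * y j ^ k = 0) ∧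
      ∀ σ : K ≃+* K, (∀ j, σ (y j) = y j) → Isomorphic f (conj σ f) := by
  classical
  obtain ⟨P, hP, -⟩ := hf.totally_ramified
  obtain ⟨x, hx, hr, hm⟩ := hf.fiber_zero
  obtain ⟨Q, hQ, -⟩ := hf.fiber_one
  have hxi : x i ∈ fiber f ((0 : K) : OnePoint K) := hr ▸ Set.mem_range_self i
  obtain ⟨g, hg, hg0, hg1⟩ := exists_smul_eq_triple (P := P) (Q := Q) (R := x i)
    (fun h => notMem_fiber_infty hf.nonconstant hQ.1 (h ▸ hP))
    (fun h => notMem_fiber_infty hf.nonconstant hxi (h ▸ hP))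
    (fun h => zero_ne_one (eq_of_mem_fiber hf.nonconstant hxi (h ▸ hQ.1)))
  have hmp := mult_precomp hf.nonconstant g
  have hfib : ∀ P Q, P ∈ fiber (precomp f g) Q ↔ g • P ∈ fiber f Q := fun P Q => by
    simp only [fiber, Set.mem_ofPred_eq, hmp]
  obtain ⟨F, ξ, hF, hξ, hξ0, ha, hprod, hF1, hdvd, hn⟩ := exists_polynomial_of_normalized
    (hf.precomp g) ((hfib _ _).mpr (hg ▸ hP)) ⟨(hfib _ _).mpr (hg0 ▸ hQ.1), by
      rw [hmp, hg0]; exact hQ.2⟩ (fun j => g⁻¹ • x j) ((MulAction.injective g⁻¹).comp hx) (by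
      ext P
      rw [hfib, ← hr]
      simp only [Set.mem_range, inv_smul_eq_iff]) (fun j => by rw [hmp, smul_inv_smul, hm])
  have hlc : F.leadingCoeff ≠ 0 := by
    intro h
    rw [leadingCoeff_eq_zero.mp h] at hF1
    simp at hF1
  refine ⟨hn, ha, fun j => (ξ j)⁻¹, ?_, ?_, fun σ hσ => isomorphic_conj σ hF ?_⟩
  · have h1 := hξ i
    rw [← hg1, inv_smul_smul] at h1
    beta_reduce
    rw [← OnePoint.coe_injective h1, inv_one]
  · intro k hk1 hk
    refine sum_mul_inv_pow_eq_zero a ξ hξ0 (n - 1) ?_ k hk1 hk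
    rw [hprod, derivative_C_mul] at hdvd
    rwa [(isUnit_C.mpr (isUnit_iff_ne_zero.mpr hlc)).dvd_mul_left] at hdvd
  · have hσξ : ∀ j, σ (ξ j) = ξ j := fun j => by
      have := hσ j
      rwa [map_inv₀, inv_inj] at this
    have hσp : (∏ j, (X - C (ξ j)) ^ a j).map (σ : K →+* K) = ∏ j, (X - C (ξ j)) ^ a j := by
      rw [Polynomial.map_prod]
      refine Finset.prod_congr rfl fun j _ => ?_
      rw [Polynomial.map_pow, Polynomial.map_sub, map_X, map_C, RingEquiv.coe_toRingHom, hσξ]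
    -- The condition F(0) = 1 determines the leading coefficient from the roots.
    have hσc : σ F.leadingCoeff = F.leadingCoeff := by
      have h1 : F.leadingCoeff * (∏ j, (X - C (ξ j)) ^ a j).eval 0 = 1 := by
        rw [← hF1]
        conv_rhs => rw [hprod]
        rw [eval_mul, eval_C]
      have h2 : σ ((∏ j, (X - C (ξ j)) ^ a j).eval 0) = (∏ j, (X - C (ξ j)) ^ a j).eval 0 := by
        conv_rhs => rw [← hσp, ← map_zero (σ : K →+* K), eval_map_apply]
        rfl
      rw [eq_inv_of_mul_eq_one_left h1, map_inv₀, h2]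
    conv_lhs => rw [hprod]
    rw [Polynomial.map_mul, map_C, RingEquiv.coe_toRingHom, hσc, hσp, ← hprod]

theorem numberField_fieldOfModuli_and_ramificationIdx_le {K : Type*} [Field K] [IsAlgClosed K]
    [CharZero K] [Algebra.IsAlgebraic ℚ K] {n : ℕ} (a : Fin n → ℕ) (T : Tree K a)
    (i : Fin n) (p : ℕ) (hpn : n < p) (hp : IsRegularPrime a i p)
    (h m : ℕ) (ham : a i = p ^ h * m) (hm : Nat.Coprime p m) :
    NumberField (fieldOfModuli ℚ T) ∧
      ∀ 𝔭 : Ideal (𝓞 (fieldOfModuli ℚ T)), 𝔭.IsMaximal → 𝔭.LiesOver (Ideal.span {(p : ℤ)}) →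
        𝔭.ramificationIdx ℤ ≤ (n - 1) / Nat.gcd (n - 1) h := by
  have : Normal ℚ K := by
    have : IsAlgClosure ℚ K := ⟨inferInstance, inferInstance⟩
    exact IsAlgClosure.normal ℚ K
  have : IsGalois ℚ K := ⟨⟩
  obtain ⟨⟨f, hf⟩, rfl⟩ := Quotient.exists_rep T
  obtain ⟨hn, ha, y, hyi, hy, hiso⟩ := exists_powerSums_of_isCover hf i
  set T : Tree K a := Quotient.mk _ ⟨f, hf⟩ with hT
  have hfix : ∀ σ : K ≃ₐ[ℚ] K, (∀ j, σ (y j) = y j) →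
      ∀ x ∈ fieldOfModuli ℚ T, σ x = x := fun σ hσ x hx =>
    hx σ ⟨f, hf, rfl, hiso σ.toRingEquiv hσ⟩
  have hint : ∀ x : K, IsIntegral ℚ x := fun x =>
    (Algebra.IsAlgebraic.isAlgebraic x).isIntegral
  have hle : fieldOfModuli ℚ T ≤ IntermediateField.adjoin ℚ (Set.range y) := by
    intro x hx
    -- By the Galois correspondence for K/ℚ, it suffices that automorphisms fixing the `y j` fix
    -- `x`.
    rw [← InfiniteGalois.fixedField_fixingSubgroup (IntermediateField.adjoin ℚ (Set.range y)),
      IntermediateField.mem_fixedField_iff]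
    intro σ hσ
    refine hfix σ (fun j => ?_) x hx
    exact (IntermediateField.mem_fixingSubgroup_iff _ _).mp hσ _
      (IntermediateField.subset_adjoin _ _ ⟨j, rfl⟩)
  have hfd : FiniteDimensional ℚ (IntermediateField.adjoin ℚ (Set.range y)) :=
    IntermediateField.finiteDimensional_adjoin fun x _ => hint x
  have hfdF : FiniteDimensional ℚ (fieldOfModuli ℚ T) :=
    FiniteDimensional.of_injective (IntermediateField.inclusion hle).toLinearMap
      (IntermediateField.inclusion_injective hle)
  have hnf : NumberField (fieldOfModuli ℚ T) := ⟨⟩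
  refine ⟨hnf, fun 𝔭 h𝔭 h𝔭p => ?_⟩
  set d := (n - 1) / Nat.gcd (n - 1) h with hd
  have hd0 : d ≠ 0 := (Nat.div_pos (Nat.le_of_dvd (by omega) (Nat.gcd_dvd_left _ _))
    (Nat.gcd_pos_of_pos_left _ (by omega))).ne'
  obtain ⟨t, ht⟩ := IsAlgClosed.exists_pow_nat_eq
    ((p : K) ^ (h / Nat.gcd (n - 1) h)) (Nat.pos_of_ne_zero hd0)
  let E := IntermediateField.adjoin ℚ (insert t (Set.range y))
  have hEfd : FiniteDimensional ℚ E := by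
    have : Finite (insert t (Set.range y) : Set _) := ((Set.finite_range y).insert t)
    exact IntermediateField.finiteDimensional_adjoin fun x _ => hint x
  -- A finite Galois extension of ℚ containing `t`, all the `y j` and hence the field of moduli.
  let M := IntermediateField.normalClosure ℚ E K
  have hEM : E ≤ M := IntermediateField.le_normalClosure E
  have hMnf : NumberField M := ⟨⟩
  have hMnormal : Normal ℚ M := by
    convert! normalClosure.normal ℚ E K
  have hMgal : IsGalois ℚ M := ⟨⟩
  have htM : t ∈ M := hEM (IntermediateField.subset_adjoin _ _ (Set.mem_insert _ _))
  have hyM : ∀ j, y j ∈ M := fun j =>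
    hEM (IntermediateField.subset_adjoin _ _ (Set.mem_insert_of_mem _ ⟨j, rfl⟩))
  have hFM : fieldOfModuli ℚ T ≤ M := hle.trans (IntermediateField.adjoin_le_iff.mpr (by
    rintro _ ⟨j, rfl⟩
    exact hyM j))
  let : Algebra (fieldOfModuli ℚ T) M := (IntermediateField.inclusion hFM).toAlgebra
  refine ramificationIdx_le_of_powerSums (M := M) hn a i p h m hpn hp ham hm (ha i)
    (fun j => ⟨y j, hyM j⟩) (Subtype.ext hyi) (fun k hk1 hk => Subtype.ext ?_) ⟨t, htM⟩
    (Subtype.ext ?_) (fun σ hσ x => Subtype.ext ?_) 𝔭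
  · have := hy k hk1 hk
    push_cast
    exact this
  · push_cast
    exact ht
  -- The field of moduli is defined through automorphisms of `K`, so `σ` is first extended from `M`
  -- to `K`.
  · have h1 : ∀ z : M, σ.liftNormal K (z : K) = (σ z : K) := fun z =>
      σ.liftNormal_commutes K z
    have h2 := hfix (σ.liftNormal K) (fun j => ?_) x x.2
    · exact (h1 (algebraMap (fieldOfModuli ℚ T) M x)).symm.trans h2
    · exact (h1 ⟨y j, hyM j⟩).trans (congrArg Subtype.val (hσ j))

end FieldOfModuli

end DiameterFour

end

theorem corollary8p7 {n : ℕ} (a : Fin n → ℕ)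
    (T : DiameterFour.Tree (AlgebraicClosure ℚ) a)
    (i : Fin n) (p : ℕ) (hpn : n < p) (hp : DiameterFour.IsRegularPrime a i p)
    (h m : ℕ) (ham : a i = p ^ h * m) (hm : Nat.Coprime p m) :
    NumberField (DiameterFour.fieldOfModuli ℚ T) ∧
      ∀ 𝔭 : Ideal (𝓞 (DiameterFour.fieldOfModuli ℚ T)), 𝔭.IsMaximal →
        𝔭.LiesOver (Ideal.span {(p : ℤ)}) →
          𝔭.ramificationIdx ℤ ≤ (n - 1) / Nat.gcd (n - 1) h := by
  have : Algebra.IsAlgebraic ℚ (AlgebraicClosure ℚ) := by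
    convert! AlgebraicClosure.isAlgebraic ℚ
  exact DiameterFour.numberField_fieldOfModuli_and_ramificationIdx_le a T i p hpn hp h m ham hm
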